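/- Let $t_0<T$, let $a,\sigma_1,\dots,\sigma_m:[t_0,T]\times\mathbb{R}^d\to\mathbb{R}^d$ be the coefficients of the It\^o SDE $dX=a(t,X)\,dt+\sum_{r=1}^m\sigma_r(t,X)\,dw_r(t)$, $X(t_0)=X_0$, and assume that there are constants $c_1,c_2,L_1,L_2\ge 0$, $\varkappa\ge1$ and $a_0,L_0$ such that, for all $t\in[t_0,T]$, $x,y\in\mathbb{R}^d$ and $r=1,\dots,m$: (i) $\mathbb{E}|X_0|^{2q}<\infty$ for all $q\ge 1$; (ii) $(x-y,\,a(t,x)-a(t,y))\le c_1|x-y|^2$; (iii) $|a(t,x)-a(t,y)|^2\le c_2\left(1+|x|^{2\varkappa-2}+|y|^{2\varkappa-2}\right)|x-y|^2$; (iv) $\sigma_r(t,\cdot)$ is continuously differentiable, $|\nabla\sigma_r(t,x)|\le L_1$ and $|\nabla\sigma_r(t,x)\sigma_r(t,x)-\nabla\sigma_r(t,y)\sigma_r(t,y)|\le L_2|x-y|$; (v) $|a(t,0)|\le a_0$ and $|\sigma_r(t,0)|\le L_0$. Let $1/2<\lambda\le1$, $l\ge 1$ and $0<\varepsilon<1$,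 and let $h_0>0$ be such that $$\lambda\left[hc_1+m\lambda L_2h+mL_1\sqrt{2lh|\ln h|}\right]\le 1-\varepsilon\qquad\text{for all }0<h\le h_0 .$$ For $N\ge1$, $h=(T-t_0)/N$, $t_k=t_0+kh$, $t_{k+\lambda}=t_k+\lambda h$, let $X_0,X_1,\dots,X_N$ be given by the fully implicit scheme $$X_{k+1}=X_k+a(t_{k+\lambda},U_{k+1})h-\lambda\sum_{r=1}^m\sum_{j=1}^d\frac{\partial\sigma_r}{\partial x^j}(t_{k+\lambda},U_{k+1})\,\sigma_r^j(t_{k+\lambda},U_{k+1})\,h+\sum_{r=1}^m\sigma_r(t_{k+\lambda},U_{k+1})\,(\zeta_{rh})_k\sqrt h ,$$ $$U_{k+1}=(1-\lambda)X_k+\lambda X_{k+1},\qquad k=0,\dots,N-1,$$ where $(\zeta_{rh})_k=\max\bigl(-A_h,\min(A_h,\xi_{rk})\bigr)$, $A_h=\sqrt{2l|\ln h|}$, and the $\xi_{rk}$ are i.i.d. $\mathcal{N}(0,1)$ random variables, jointly independent of $X_0$. Then for every real $p\ge1$ there is a constant $K>0$ such that, whenever $0<h\le h_0$ and for all $k=0,\dots,N$,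 $$\mathbb{E}|X_k|^{2p}\le K\left(1+\mathbb{E}|X_0|^{2p}\right)$$ (in particular the left-hand side is finite). The constant $K$ depends only on $p$, $d$, $m$, $t_0$, $T$, $\lambda$, $l$, $\varepsilon$, $h_0$ and on the constants $c_1,c_2,\varkappa,L_1,L_2,a_0,L_0$; in particular it does not depend on $h$, $N$, $k$ or $X_0$. -/

import Mathlib

open MeasureTheory ProbabilityTheory

/-- Assumptions on the coefficients `a(t,x)` and `σ_r(t,x)`, `r = 1,…,m`, of the Itô SDE
`dX = a(t,X) dt + ∑_r σ_r(t,X) dw_r(t)` on `[t₀,T]`: one-sided Lipschitz drift of polynomial growth,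
and diffusion coefficients with continuous bounded first spatial derivatives. The Jacobian
`∇σ_r(t,x)` is `fderiv ℝ (σ r t) x`, so `∇σ_r σ_r = ∑_j (∂σ_r/∂x^j) σ_r^j` is
`fderiv ℝ (σ r t) x (σ r t x)`, and the norm of the Jacobian is the operator norm. -/
structure CoeffAssumption {d m : ℕ} (t₀ T : ℝ)
    (a : ℝ → EuclideanSpace ℝ (Fin d) → EuclideanSpace ℝ (Fin d))
    (σ : Fin m → ℝ → EuclideanSpace ℝ (Fin d) → EuclideanSpace ℝ (Fin d))
    (c₁ c₂ κ L₁ L₂ : ℝ) : Prop where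
  one_sided_lipschitz : ∀ t ∈ Set.Icc t₀ T, ∀ x y : EuclideanSpace ℝ (Fin d),
    inner ℝ (x - y) (a t x - a t y) ≤ c₁ * ‖x - y‖ ^ 2
  poly_lipschitz : ∀ t ∈ Set.Icc t₀ T, ∀ x y : EuclideanSpace ℝ (Fin d),
    ‖a t x - a t y‖ ^ 2
      ≤ c₂ * (1 + ‖x‖ ^ (2 * κ - 2) + ‖y‖ ^ (2 * κ - 2)) * ‖x - y‖ ^ 2
  diffusion_contDiff : ∀ r, ∀ t ∈ Set.Icc t₀ T, ContDiff ℝ 1 (σ r t)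
  diffusion_deriv_bound : ∀ r, ∀ t ∈ Set.Icc t₀ T, ∀ x : EuclideanSpace ℝ (Fin d),
    ‖fderiv ℝ (σ r t) x‖ ≤ L₁
  diffusion_corr_lipschitz : ∀ r, ∀ t ∈ Set.Icc t₀ T, ∀ x y : EuclideanSpace ℝ (Fin d),
    ‖fderiv ℝ (σ r t) x (σ r t x) - fderiv ℝ (σ r t) y (σ r t y)‖ ≤ L₂ * ‖x - y‖

/-- The truncation level `A_h = √(2 l |ln h|)`. -/
noncomputable def truncLevel (l h : ℝ) : ℝ := Real.sqrt (2 * l * |Real.log h|)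

/-- The truncated variable `ζ_h`: it is `ξ` if `|ξ| ≤ A_h`, `A_h` if `ξ > A_h`
and `-A_h` if `ξ < -A_h`. -/
noncomputable def truncNoise (l h ξ : ℝ) : ℝ :=
  if |ξ| ≤ truncLevel l h then ξ
  else if truncLevel l h < ξ then truncLevel l h
  else -truncLevel l h

/-- The fully implicit one-step relation, with step `h`, from `x` to `y`, where `s = t + λ h` is the
time at which the coefficients are evaluated and `z r` are the noise values. -/
def ImplicitStep {d m : ℕ}
    (a : ℝ → EuclideanSpace ℝ (Fin d) → EuclideanSpace ℝ (Fin d))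
    (σ : Fin m → ℝ → EuclideanSpace ℝ (Fin d) → EuclideanSpace ℝ (Fin d))
    (lam h s : ℝ) (z : Fin m → ℝ) (x y : EuclideanSpace ℝ (Fin d)) : Prop :=
  let U := (1 - lam) • x + lam • y
  y = x + h • a s U
    - (lam * h) • ∑ r, fderiv ℝ (σ r s) U (σ r s U)
    + ∑ r, (z r * Real.sqrt h) • σ r s U

/-- `X_0,…,X_N` is (almost surely) a solution of the fully implicit scheme on the uniform grid
`t_k = t₀ + k h`, driven by the truncations of the random variables `ξ_{rk}`. -/
def IsImplicitScheme {d m N : ℕ} {Ω : Type*} [MeasurableSpace Ω] (P : Measure Ω)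
    (a : ℝ → EuclideanSpace ℝ (Fin d) → EuclideanSpace ℝ (Fin d))
    (σ : Fin m → ℝ → EuclideanSpace ℝ (Fin d) → EuclideanSpace ℝ (Fin d))
    (t₀ lam l h : ℝ) (ξ : Fin N → Fin m → Ω → ℝ)
    (X : Fin (N + 1) → Ω → EuclideanSpace ℝ (Fin d)) : Prop :=
  ∀ k : Fin N, ∀ᵐ ω ∂P,
    ImplicitStep a σ lam h (t₀ + (k : ℕ) * h + lam * h)
      (fun r => truncNoise l h (ξ k r ω)) (X k.castSucc ω) (X k.succ ω)

/-! Write one step as y = x + F(u) with u = (1-λ)x + λy, and put D = y - x, V(x) = 1 + |x|². Then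
|y|² = |x|² + 2(u, D) - (2λ-1)|D|². The one-sided condition bounds the drift part of (u, D) by O(h)
V(u). Moving the noise terms from u to x costs multiples of |D|², which for small h are absorbed by
-(2λ-1)|D|² (`FieldBounds.normSq_step_le`). Hence V(y) is at most V(x) times 1 plus √h times a
linear form in the noise plus O(h)(1 + ∑ z_r²). Since √h A_h → 0, taking p-th powers keeps this
shape (`FieldBounds.rpow_step_le`).

For h bounded away from 0 the step condition still gives linear growth of y in x
(`FieldBounds.norm_step_le`), and a constant factor is then itself O(h). Thus
`exists_step_moment_bound` covers every h ≤ h₀.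

In expectation the linear form vanishes, because ζ is symmetric and independent of the past, while E
ζ² ≤ 1. So E V(X_{k+1})^p ≤ (1 + C'h) E V(X_k)^p, and at most N steps produce at most the factor
exp(C'(T-t₀)).

Independence requires X_k to be a function of X_0 and the earlier noise, although X_k is only given
as some a.s. solution. The step condition makes solutions unique (`FieldBounds.step_unique`), and
uniqueness makes them measurable in the data (`exists_measurable_step_solution`).
`IsImplicitScheme.moment_growth` carries measurability and moments through one induction. -/

/-- The increment of one step of the fully implicit scheme as a function of the intermediate
point `u`, for drift `A`, diffusion fields `S` and correction fields `B`. -/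
noncomputable def stepIncrement {E : Type*} [NormedAddCommGroup E] [InnerProductSpace ℝ E] {m : ℕ}
    (A : E → E) (S B : Fin m → E → E) (lam h : ℝ) (z : Fin m → ℝ) (u : E) : E :=
  h • A u - (lam * h) • ∑ r, B r u + ∑ r, (z r * Real.sqrt h) • S r u

/-- Uniform bounds on the coefficient fields at a fixed time. -/
structure FieldBounds {E : Type*} [NormedAddCommGroup E] [InnerProductSpace ℝ E] {m : ℕ}
    (A : E → E) (S B : Fin m → E → E) (c₁ a₀ L₁ L₀ L₂ b₀ : ℝ) : Prop where
  drift : ∀ x y, inner ℝ (x - y) (A x - A y) ≤ c₁ * ‖x - y‖ ^ 2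
  drift_zero : ‖A 0‖ ≤ a₀
  diff : ∀ r x y, ‖S r x - S r y‖ ≤ L₁ * ‖x - y‖
  diff_zero : ∀ r, ‖S r 0‖ ≤ L₀
  corr : ∀ r x y, ‖B r x - B r y‖ ≤ L₂ * ‖x - y‖
  corr_zero : ∀ r, ‖B r 0‖ ≤ b₀

/-! ### Uniqueness and linear growth for the implicit equation -/

section Step

variable {E : Type*} [NormedAddCommGroup E] [InnerProductSpace ℝ E] {m : ℕ}
  {A : E → E} {S B : Fin m → E → E} {c₁ a₀ L₁ L₀ L₂ b₀ lam h Z ε : ℝ} {z : Fin m → ℝ}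

lemma FieldBounds.norm_diff_le (H : FieldBounds A S B c₁ a₀ L₁ L₀ L₂ b₀) (r : Fin m) (x : E) :
    ‖S r x‖ ≤ L₀ + L₁ * ‖x‖ := by
  have h1 := H.diff r x 0
  rw [sub_zero] at h1
  have h2 := norm_sub_norm_le (S r x) (S r 0)
  linarith [H.diff_zero r]

lemma FieldBounds.norm_corr_le (H : FieldBounds A S B c₁ a₀ L₁ L₀ L₂ b₀) (r : Fin m) (x : E) :
    ‖B r x‖ ≤ b₀ + L₂ * ‖x‖ := by
  have h1 := H.corr r x 0
  rw [sub_zero] at h1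
  have h2 := norm_sub_norm_le (B r x) (B r 0)
  linarith [H.corr_zero r]

lemma FieldBounds.inner_drift_le (H : FieldBounds A S B c₁ a₀ L₁ L₀ L₂ b₀) (x : E) :
    inner ℝ x (A x) ≤ c₁ * ‖x‖ ^ 2 + a₀ * ‖x‖ := by
  have h1 := H.drift x 0
  rw [sub_zero, inner_sub_right] at h1
  have h2 := real_inner_le_norm x (A 0)
  nlinarith [H.drift_zero, norm_nonneg x]

/-- One-sided Lipschitz bound for the increment. -/
lemma FieldBounds.inner_stepIncrement_sub_le (H : FieldBounds A S B c₁ a₀ L₁ L₀ L₂ b₀)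
    (hlam : 0 ≤ lam) (hh : 0 ≤ h) (hz : ∀ r, |z r| ≤ Z) (u v : E) :
    inner ℝ (u - v) (stepIncrement A S B lam h z u - stepIncrement A S B lam h z v)
      ≤ (h * c₁ + m * lam * L₂ * h + m * L₁ * (Real.sqrt h * Z)) * ‖u - v‖ ^ 2 := by
  have e : stepIncrement A S B lam h z u - stepIncrement A S B lam h z v
      = h • (A u - A v) - (lam * h) • ∑ r, (B r u - B r v)
        + ∑ r, (z r * Real.sqrt h) • (S r u - S r v) := by
    simp only [stepIncrement, smul_sub, Finset.sum_sub_distrib]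
    abel
  rw [e, inner_add_right, inner_sub_right, inner_smul_right, inner_smul_right, inner_sum,
    inner_sum]
  have h1 := mul_le_mul_of_nonneg_left (H.drift u v) hh
  have h2 : -∑ r, inner ℝ (u - v) (B r u - B r v) ≤ m * (L₂ * ‖u - v‖ ^ 2) := by
    rw [← Finset.sum_neg_distrib]
    refine (Finset.sum_le_card_nsmul _ _ (L₂ * ‖u - v‖ ^ 2) fun r _ => ?_).trans (by simp)
    have := abs_real_inner_le_norm (u - v) (B r u - B r v)
    nlinarith [neg_abs_le (inner ℝ (u - v) (B r u - B r v)), H.corr r u v, norm_nonneg (u - v)]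
  have h3 : ∑ r, inner ℝ (u - v) ((z r * Real.sqrt h) • (S r u - S r v))
      ≤ m * (L₁ * (Real.sqrt h * Z) * ‖u - v‖ ^ 2) := by
    refine (Finset.sum_le_card_nsmul _ _ (L₁ * (Real.sqrt h * Z) * ‖u - v‖ ^ 2)
      fun r _ => ?_).trans (by simp)
    rw [inner_smul_right]
    refine (le_abs_self _).trans ?_
    rw [abs_mul, abs_mul, abs_of_nonneg (Real.sqrt_nonneg h)]
    have h4 : |inner ℝ (u - v) (S r u - S r v)| ≤ L₁ * ‖u - v‖ ^ 2 := by
      have := abs_real_inner_le_norm (u - v) (S r u - S r v)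
      nlinarith [H.diff r u v, norm_nonneg (u - v)]
    calc |z r| * √h * |inner ℝ (u - v) (S r u - S r v)|
        ≤ Z * √h * (L₁ * ‖u - v‖ ^ 2) := by
          have : 0 ≤ Z := (abs_nonneg _).trans (hz r)
          gcongr
          exact hz r
      _ = _ := by ring
  have h2' := mul_le_mul_of_nonneg_left h2 (mul_nonneg hlam hh)
  nlinarith

lemma FieldBounds.norm_stepIncrement_zero_le (H : FieldBounds A S B c₁ a₀ L₁ L₀ L₂ b₀)
    (hlam : 0 ≤ lam) (hh : 0 ≤ h) (hz : ∀ r, |z r| ≤ Z) :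
    ‖stepIncrement A S B lam h z 0‖ ≤ h * a₀ + lam * h * (m * b₀) + m * (Z * Real.sqrt h * L₀) := by
  unfold stepIncrement
  refine (norm_add_le _ _).trans (add_le_add ((norm_sub_le _ _).trans (add_le_add ?_ ?_)) ?_)
  · rw [norm_smul, Real.norm_of_nonneg hh]
    exact mul_le_mul_of_nonneg_left H.drift_zero hh
  · rw [norm_smul, Real.norm_of_nonneg (mul_nonneg hlam hh)]
    refine mul_le_mul_of_nonneg_left ?_ (mul_nonneg hlam hh)
    refine (norm_sum_le _ _).trans ?_
    exact (Finset.sum_le_card_nsmul _ _ b₀ fun r _ => H.corr_zero r).trans (by simp)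
  · refine (norm_sum_le _ _).trans ?_
    refine (Finset.sum_le_card_nsmul _ _ (Z * Real.sqrt h * L₀) fun r _ => ?_).trans (by simp)
    rw [norm_smul, Real.norm_eq_abs, abs_mul, abs_of_nonneg (Real.sqrt_nonneg h)]
    have : 0 ≤ Z := (abs_nonneg _).trans (hz r)
    have := H.diff_zero r
    gcongr
    exact hz r

/-- The implicit equation has at most one solution. -/
lemma FieldBounds.step_unique (H : FieldBounds A S B c₁ a₀ L₁ L₀ L₂ b₀)
    (hlam : 0 < lam) (hh : 0 ≤ h) (hz : ∀ r, |z r| ≤ Z) (hε : 0 < ε)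
    (hθ : lam * (h * c₁ + m * lam * L₂ * h + m * L₁ * (Real.sqrt h * Z)) ≤ 1 - ε)
    {x y y' : E}
    (hy : y = x + stepIncrement A S B lam h z ((1 - lam) • x + lam • y))
    (hy' : y' = x + stepIncrement A S B lam h z ((1 - lam) • x + lam • y')) : y = y' := by
  set u := (1 - lam) • x + lam • y with hu
  set v := (1 - lam) • x + lam • y' with hv
  have huv : u - v = lam • (y - y') := by rw [hu, hv, smul_sub]; abel
  have key := H.inner_stepIncrement_sub_le hlam.le hh hz u v
  have hF : stepIncrement A S B lam h z u - stepIncrement A S B lam h z v = y - y' := by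
    rw [hy, hy']; simp
  have hself : inner ℝ (u - v) (lam • (y - y')) = ‖u - v‖ ^ 2 := by
    rw [← huv, real_inner_self_eq_norm_sq]
  rw [hF] at key
  rw [inner_smul_right] at hself
  have h1 := mul_le_mul_of_nonneg_left key hlam.le
  -- Here ‖u - v‖² = λ (u - v, y - y'), so the step condition yields ‖u - v‖² ≤ (1 - ε) ‖u - v‖².
  have h2 : ε * ‖u - v‖ ^ 2 ≤ 0 := by nlinarith [sq_nonneg ‖u - v‖]
  have h3 : ‖u - v‖ ^ 2 = 0 :=
    le_antisymm (by by_contra hc; push Not at hc; nlinarith) (sq_nonneg _)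
  have h4 : u - v = 0 := by simpa using h3
  rw [huv, smul_eq_zero] at h4
  rcases h4 with h4 | h4
  · exact absurd h4 hlam.ne'
  · exact sub_eq_zero.mp h4

/-- Linear growth of the solution of the implicit equation. -/
lemma FieldBounds.norm_step_le (H : FieldBounds A S B c₁ a₀ L₁ L₀ L₂ b₀)
    (hlam : 1 / 2 < lam) (hlam1 : lam ≤ 1) (hh : 0 ≤ h) (hz : ∀ r, |z r| ≤ Z) (hε : 0 < ε)
    (hθ : lam * (h * c₁ + m * lam * L₂ * h + m * L₁ * (Real.sqrt h * Z)) ≤ 1 - ε)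
    {x y : E}
    (hy : y = x + stepIncrement A S B lam h z ((1 - lam) • x + lam • y)) :
    ‖y‖ ≤ 2 * ((‖x‖ + (h * a₀ + lam * h * (m * b₀) + m * (Z * Real.sqrt h * L₀))) / ε + ‖x‖) := by
  have hlam0 : 0 < lam := by linarith
  set u := (1 - lam) • x + lam • y with hu
  have key := H.inner_stepIncrement_sub_le hlam0.le hh hz u 0
  have h0 := H.norm_stepIncrement_zero_le hlam0.le hh hz
  set C := h * a₀ + lam * h * (m * b₀) + m * (Z * Real.sqrt h * L₀)
  -- The intermediate point solves its own fixed-point equation; testing it with u brings in the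
  -- one-sided bound.
  have hux : u = x + lam • stepIncrement A S B lam h z u := by
    rw [eq_sub_of_add_eq' hy.symm, hu]
    module
  rw [sub_zero, inner_sub_right] at key
  have h1 : ‖u‖ ^ 2 = inner ℝ u x + lam * inner ℝ u (stepIncrement A S B lam h z u) := by
    rw [← inner_smul_right, ← inner_add_right, ← hux, real_inner_self_eq_norm_sq]
  have h2 := real_inner_le_norm u x
  have h3 := real_inner_le_norm u (stepIncrement A S B lam h z 0)
  have hun := norm_nonneg u
  have h4 : ε * ‖u‖ ^ 2 ≤ ‖u‖ * (‖x‖ + C) := by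
    have e1 := mul_le_mul_of_nonneg_left key hlam0.le
    have e2 := mul_le_mul_of_nonneg_right hθ (sq_nonneg ‖u‖)
    have e3 : lam * inner ℝ u (stepIncrement A S B lam h z 0) ≤ ‖u‖ * C := by
      have hC : inner ℝ u (stepIncrement A S B lam h z 0) ≤ ‖u‖ * C :=
        h3.trans (mul_le_mul_of_nonneg_left h0 hun)
      have : 0 ≤ ‖u‖ * C := mul_nonneg hun ((norm_nonneg _).trans h0)
      nlinarith
    nlinarith
  have h5 : ‖u‖ ≤ (‖x‖ + C) / ε := by
    rw [le_div_iff₀ hε]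
    rcases hun.eq_or_lt with h0u | h0u
    · rw [← h0u, zero_mul]
      exact add_nonneg (norm_nonneg _) ((norm_nonneg _).trans h0)
    · nlinarith
  -- Recovering y from u divides by λ; the factor 2 of the conclusion is a bound for 1/λ.
  have h6 : lam * ‖y‖ ≤ ‖u‖ + (1 - lam) * ‖x‖ := by
    have : lam • y = u - (1 - lam) • x := by rw [hu]; abel
    have h7 := norm_sub_le u ((1 - lam) • x)
    rwa [← this, norm_smul, norm_smul, Real.norm_of_nonneg hlam0.le,
      Real.norm_of_nonneg (by linarith : 0 ≤ 1 - lam)] at h7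
  nlinarith [norm_nonneg x, norm_nonneg y]

end Step

/-! ### Energy estimate and p-th powers for small steps -/

section SmallStep

variable {E : Type*} [NormedAddCommGroup E] [InnerProductSpace ℝ E] {m : ℕ}
  {A : E → E} {S B : Fin m → E → E} {c₁ a₀ L₁ L₀ L₂ b₀ lam h Z ε : ℝ} {z : Fin m → ℝ}

/-- Split into (u - x, S u) + (x, S u - S x). The part of first order in δ grows only linearly in
‖x‖, so its square after Young's inequality is controlled by 1 + ‖x‖². -/
lemma FieldBounds.inner_diff_sub_le (H : FieldBounds A S B c₁ a₀ L₁ L₀ L₂ b₀)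
    (hL₁ : 0 ≤ L₁) (hL₀ : 0 ≤ L₀) (r : Fin m) (u x : E) {δ : ℝ} (hux : ‖u - x‖ ≤ δ) :
    |inner ℝ u (S r u) - inner ℝ x (S r x)|
      ≤ (L₀ + 2 * L₁) * δ * (1 + ‖x‖) + L₁ * δ ^ 2 := by
  have e : inner ℝ u (S r u) - inner ℝ x (S r x)
      = inner ℝ (u - x) (S r u) + inner ℝ x (S r u - S r x) := by
    rw [inner_sub_left, inner_sub_right]; ring
  rw [e]
  have h1 := abs_real_inner_le_norm (u - x) (S r u)
  have h2 := abs_real_inner_le_norm x (S r u - S r x)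
  have h3 := abs_add_le (inner ℝ (u - x) (S r u)) (inner ℝ x (S r u - S r x))
  have hδ : 0 ≤ δ := (norm_nonneg _).trans hux
  have hxn := norm_nonneg x
  have hSu : ‖S r u‖ ≤ L₀ + L₁ * (‖x‖ + δ) := by
    refine (H.norm_diff_le r u).trans ?_
    have : ‖u‖ ≤ ‖x‖ + δ := by
      have := norm_add_le x (u - x)
      rw [add_sub_cancel] at this
      linarith
    gcongr
  have hd : ‖S r u - S r x‖ ≤ L₁ * δ :=
    (H.diff r u x).trans (mul_le_mul_of_nonneg_left hux hL₁)
  have h4 : ‖u - x‖ * ‖S r u‖ ≤ δ * (L₀ + L₁ * (‖x‖ + δ)) := by gcongr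
  have h5 : ‖x‖ * ‖S r u - S r x‖ ≤ ‖x‖ * (L₁ * δ) := by gcongr
  nlinarith [mul_nonneg hL₀ (mul_nonneg hδ hxn), mul_nonneg hL₁ hδ]

/-- Comparison of a noise term at `u` with the same term at the nearby point `x`. -/
lemma FieldBounds.noise_term_le (H : FieldBounds A S B c₁ a₀ L₁ L₀ L₂ b₀)
    (hL₁ : 0 ≤ L₁) (hL₀ : 0 ≤ L₀) (r : Fin m) (u x : E) {δ η w ζ : ℝ} (hux : ‖u - x‖ ≤ δ)
    (hη : 0 < η) (hw : 0 ≤ w) (hζ : |ζ| ≤ Z) :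
    ζ * w * inner ℝ u (S r u) ≤ ζ * w * inner ℝ x (S r x)
      + (η * δ ^ 2 + (L₀ + 2 * L₁) ^ 2 / (2 * η) * (w * w) * ζ ^ 2 * (1 + ‖x‖ ^ 2)
        + L₁ * (w * Z) * δ ^ 2) := by
  have h1 := H.inner_diff_sub_le hL₁ hL₀ r u x hux
  generalize L₀ + 2 * L₁ = G at h1 ⊢
  generalize inner ℝ u (S r u) = i at h1 ⊢
  generalize inner ℝ x (S r x) = j at h1 ⊢
  have h2 : ζ * w * (i - j) ≤ |ζ| * w * (G * δ * (1 + ‖x‖) + L₁ * δ ^ 2) := by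
    refine (le_abs_self _).trans ?_
    rw [abs_mul, abs_mul, abs_of_nonneg hw]
    exact mul_le_mul_of_nonneg_left h1 (by positivity)
  have h3 : |ζ| * w * (L₁ * δ ^ 2) ≤ L₁ * (w * Z) * δ ^ 2 := by
    calc |ζ| * w * (L₁ * δ ^ 2) ≤ Z * w * (L₁ * δ ^ 2) := by gcongr
      _ = _ := by ring
  have h4 : |ζ| * w * (G * δ * (1 + ‖x‖))
      ≤ η * δ ^ 2 + G ^ 2 / (2 * η) * (w * w) * ζ ^ 2 * (1 + ‖x‖ ^ 2) := by
    obtain ⟨q, hq⟩ : ∃ q, q = |ζ| * w * G * (1 + ‖x‖) := ⟨_, rfl⟩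
    -- Young's inequality with weight η: the δ² part goes to the dissipation, while q² carries w²ζ²,
    -- of order h in mean.
    have h5 : δ * q ≤ η * δ ^ 2 + q ^ 2 / (4 * η) := by
      have e : η * δ ^ 2 + q ^ 2 / (4 * η) - δ * q = (2 * η * δ - q) ^ 2 / (4 * η) := by
        field_simp; ring
      have : 0 ≤ (2 * η * δ - q) ^ 2 / (4 * η) := by positivity
      linarith
    have h6 : q ^ 2 = ζ ^ 2 * (w * w) * G ^ 2 * (1 + ‖x‖) ^ 2 := by
      rw [hq, ← sq_abs ζ]; ring
    have h8 : (1 + ‖x‖) ^ 2 ≤ 2 * (1 + ‖x‖ ^ 2) := by nlinarith [sq_nonneg (‖x‖ - 1)]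
    have h7 : q ^ 2 / (4 * η) ≤ G ^ 2 / (2 * η) * (w * w) * ζ ^ 2 * (1 + ‖x‖ ^ 2) := by
      rw [h6]
      calc ζ ^ 2 * (w * w) * G ^ 2 * (1 + ‖x‖) ^ 2 / (4 * η)
          ≤ ζ ^ 2 * (w * w) * G ^ 2 * (2 * (1 + ‖x‖ ^ 2)) / (4 * η) := by gcongr
        _ = _ := by field_simp; ring
    calc |ζ| * w * (G * δ * (1 + ‖x‖)) = δ * q := by rw [hq]; ring
      _ ≤ _ := h5
      _ ≤ _ := by linarith
  linarith

/-- Bound for the drift and correction terms tested with `u`. -/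
lemma FieldBounds.inner_drift_corr_le (H : FieldBounds A S B c₁ a₀ L₁ L₀ L₂ b₀)
    (hc₁ : 0 ≤ c₁) (ha₀ : 0 ≤ a₀) (hL₂ : 0 ≤ L₂) (hb₀ : 0 ≤ b₀)
    (hlam : 0 ≤ lam) (hlam1 : lam ≤ 1) (hh : 0 ≤ h) (u : E) :
    h * inner ℝ u (A u) - lam * h * ∑ r, inner ℝ u (B r u)
      ≤ (c₁ + a₀ + m * (L₂ + b₀)) * h * (1 + ‖u‖ ^ 2) := by
  have hun := norm_nonneg u
  have hA : inner ℝ u (A u) ≤ c₁ * ‖u‖ ^ 2 + a₀ * (1 + ‖u‖ ^ 2) := by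
    have := H.inner_drift_le u
    nlinarith [sq_nonneg (‖u‖ - 1), mul_nonneg ha₀ (sq_nonneg (‖u‖ - 1))]
  have hB : -∑ r, inner ℝ u (B r u) ≤ m * (L₂ + b₀) * (1 + ‖u‖ ^ 2) := by
    rw [← Finset.sum_neg_distrib]
    refine (Finset.sum_le_card_nsmul _ _ ((L₂ + b₀) * (1 + ‖u‖ ^ 2)) fun r _ => ?_).trans
      (by simp [mul_assoc])
    have h1 := abs_real_inner_le_norm u (B r u)
    have h2 := neg_abs_le (inner ℝ u (B r u))
    have h3 := mul_le_mul_of_nonneg_left (H.norm_corr_le r u) hun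
    nlinarith [mul_nonneg hb₀ (sq_nonneg (‖u‖ - 1)), mul_nonneg hb₀ (sq_nonneg ‖u‖)]
  have hpos : 0 ≤ m * (L₂ + b₀) * (1 + ‖u‖ ^ 2) := by positivity
  have hB' : lam * -∑ r, inner ℝ u (B r u) ≤ m * (L₂ + b₀) * (1 + ‖u‖ ^ 2) := by nlinarith
  calc h * inner ℝ u (A u) - lam * h * ∑ r, inner ℝ u (B r u)
      = h * (inner ℝ u (A u) + lam * -∑ r, inner ℝ u (B r u)) := by ring
    _ ≤ h * ((c₁ + a₀ + m * (L₂ + b₀)) * (1 + ‖u‖ ^ 2)) := by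
        refine mul_le_mul_of_nonneg_left ?_ hh
        nlinarith [hc₁]
    _ = _ := by ring

/-- Energy estimate for one step of the scheme. -/
lemma FieldBounds.normSq_step_le (H : FieldBounds A S B c₁ a₀ L₁ L₀ L₂ b₀)
    (hc₁ : 0 ≤ c₁) (ha₀ : 0 ≤ a₀) (hL₁ : 0 ≤ L₁) (hL₀ : 0 ≤ L₀) (hL₂ : 0 ≤ L₂) (hb₀ : 0 ≤ b₀)
    (hlam : 1 / 2 < lam) (hlam1 : lam ≤ 1) (hh : 0 ≤ h) (hz : ∀ r, |z r| ≤ Z)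
    (hsmall1 : 16 * (c₁ + a₀ + m * (L₂ + b₀)) * h ≤ 2 * lam - 1)
    (hsmall2 : 8 * m * L₁ * (Real.sqrt h * Z) ≤ 2 * lam - 1)
    {x y : E}
    (hy : y = x + stepIncrement A S B lam h z ((1 - lam) • x + lam • y)) :
    ‖y‖ ^ 2 ≤ ‖x‖ ^ 2 + 2 * Real.sqrt h * ∑ r, z r * inner ℝ x (S r x)
      + (4 * (c₁ + a₀ + m * (L₂ + b₀)) + 4 * (L₀ + 2 * L₁) ^ 2 * (m + 1) / (2 * lam - 1))
        * h * (1 + ∑ r, z r ^ 2) * (1 + ‖x‖ ^ 2) := by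
  set c := c₁ + a₀ + m * (L₂ + b₀) with hc
  set G := L₀ + 2 * L₁ with hG
  set w := Real.sqrt h with hw
  have hw0 : 0 ≤ w := Real.sqrt_nonneg h
  have hww : w * w = h := Real.mul_self_sqrt hh
  set u := (1 - lam) • x + lam • y with hu
  set D := y - x with hD
  have hxu : x = u - lam • D := by rw [hu, hD]; module
  have hyu : y = u + (1 - lam) • D := by rw [hu, hD]; module
  have hDF : D = stepIncrement A S B lam h z u := by rw [hD, sub_eq_iff_eq_add', ← hy]
  -- The coefficient of ‖D‖² is (1-λ)² - λ² = 1 - 2λ, negative exactly because λ > 1/2.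
  have hsq : ‖y‖ ^ 2 = ‖x‖ ^ 2 + 2 * inner ℝ u D + (1 - 2 * lam) * ‖D‖ ^ 2 := by
    rw [hyu, hxu, norm_add_sq_real, norm_sub_sq_real, inner_smul_right, inner_smul_right,
      norm_smul, norm_smul, mul_pow, mul_pow, Real.norm_eq_abs, Real.norm_eq_abs, sq_abs, sq_abs]
    ring
  have hin : inner ℝ u D = h * inner ℝ u (A u) - lam * h * ∑ r, inner ℝ u (B r u)
      + ∑ r, z r * w * inner ℝ u (S r u) := by
    rw [hDF, stepIncrement, inner_add_right, inner_sub_right, inner_smul_right, inner_smul_right,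
      inner_sum, inner_sum]
    simp only [inner_smul_right, hw]
  have hxn := norm_nonneg x
  have hun := norm_nonneg u
  have hDn := norm_nonneg D
  have hux : ‖u - x‖ ≤ ‖D‖ := by
    have : u - x = lam • D := by rw [hu, hD]; module
    rw [this, norm_smul, Real.norm_of_nonneg (by linarith)]
    nlinarith
  have hu2 : 1 + ‖u‖ ^ 2 ≤ 2 * (1 + ‖x‖ ^ 2 + ‖D‖ ^ 2) := by
    have := norm_add_le x (u - x)
    rw [add_sub_cancel] at this
    nlinarith [sq_nonneg (‖x‖ - ‖D‖)]
  have hdrift : h * inner ℝ u (A u) - lam * h * ∑ r, inner ℝ u (B r u)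
      ≤ 2 * c * h * (1 + ‖x‖ ^ 2 + ‖D‖ ^ 2) := by
    refine (H.inner_drift_corr_le hc₁ ha₀ hL₂ hb₀ (by linarith) hlam1 hh u).trans ?_
    have hc0 : 0 ≤ c * h := by positivity
    have := mul_le_mul_of_nonneg_left hu2 hc0
    linarith
  -- The denominator has m + 1 in place of m so that m = 0 is allowed.
  set η := (2 * lam - 1) / (4 * (m + 1)) with hη
  have hm1 : (0 : ℝ) < m + 1 := by positivity
  have hη0 : 0 < η := div_pos (by linarith) (by positivity)
  have hterm : ∀ r, z r * w * inner ℝ u (S r u) ≤ z r * w * inner ℝ x (S r x)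
      + (η * ‖D‖ ^ 2 + G ^ 2 / (2 * η) * h * z r ^ 2 * (1 + ‖x‖ ^ 2)
        + L₁ * (w * Z) * ‖D‖ ^ 2) := fun r => by
    rw [← hww]
    exact H.noise_term_le hL₁ hL₀ r u x hux hη0 hw0 (hz r)
  have hnoise : ∑ r, z r * w * inner ℝ u (S r u) ≤ w * ∑ r, z r * inner ℝ x (S r x)
      + (m * η * ‖D‖ ^ 2 + G ^ 2 / (2 * η) * h * (∑ r, z r ^ 2) * (1 + ‖x‖ ^ 2)
        + m * L₁ * (w * Z) * ‖D‖ ^ 2) := by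
    refine (Finset.sum_le_sum fun r _ => hterm r).trans (le_of_eq ?_)
    simp only [Finset.sum_add_distrib, Finset.sum_const, Finset.card_univ, Fintype.card_fin,
      nsmul_eq_mul, Finset.mul_sum, Finset.sum_mul]
    congr 1
    · exact Finset.sum_congr rfl fun r _ => by ring
    · ring
  have hmη : 4 * (m * η) ≤ 2 * lam - 1 := by
    have : 4 * (m * η) = (2 * lam - 1) * (m / (m + 1)) := by rw [hη]; field_simp
    rw [this]
    have h1 : (m : ℝ) / (m + 1) ≤ 1 := by rw [div_le_one hm1]; linarith
    nlinarith
  -- The budget 2λ - 1 is shared out: a quarter to the drift, half to the Young terms, a quarter to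
  -- the L₁ remainder.
  have hcoef : (4 * c * h + 2 * (m * η) + 2 * (m * L₁ * (w * Z)) - (2 * lam - 1)) * ‖D‖ ^ 2 ≤ 0 := by
    refine mul_nonpos_of_nonpos_of_nonneg ?_ (sq_nonneg _)
    linarith
  have hGη : 4 * G ^ 2 * (m + 1) / (2 * lam - 1) = G ^ 2 / η := by
    have : 2 * lam - 1 ≠ 0 := by linarith
    rw [hη]; field_simp
  have hV : 0 ≤ 1 + ‖x‖ ^ 2 := by positivity
  have hQ : 0 ≤ ∑ r, z r ^ 2 := Finset.sum_nonneg fun r _ => sq_nonneg _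
  rw [hGη]
  have e1 : 0 ≤ 4 * c * h * (∑ r, z r ^ 2) * (1 + ‖x‖ ^ 2) := by positivity
  have e2 : 0 ≤ G ^ 2 / η * h * (1 + ‖x‖ ^ 2) := by positivity
  have e3 : 2 * (G ^ 2 / (2 * η)) = G ^ 2 / η := by field_simp
  have e4 : 2 * (G ^ 2 / (2 * η) * h * (∑ r, z r ^ 2) * (1 + ‖x‖ ^ 2))
      = G ^ 2 / η * h * (∑ r, z r ^ 2) * (1 + ‖x‖ ^ 2) := by rw [← e3]; ring
  rw [hsq, hin]
  linarith

/-- If `V' ≤ V (1 + u)` with `|p u| ≤ 1` then `V' ^ p ≤ V ^ p (1 + p u + (p u)²)`. -/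
lemma rpow_le_rpow_mul_of_le_mul_one_add {V V' u p : ℝ} (hV : 0 ≤ V) (hV' : 0 ≤ V')
    (hp : 0 ≤ p) (h : V' ≤ V * (1 + u)) (hu : |p * u| ≤ 1) :
    V' ^ p ≤ V ^ p * (1 + p * u + (p * u) ^ 2) := by
  -- Passing through the exponential handles real p: 1 + u ≤ exp u, and exp t ≤ 1 + t + t² for |t| ≤
  -- 1.
  have h1 : V' ≤ V * Real.exp u :=
    h.trans (mul_le_mul_of_nonneg_left (by linarith [Real.add_one_le_exp u]) hV)
  have h2 := Real.rpow_le_rpow hV' h1 hp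
  rw [Real.mul_rpow hV (Real.exp_pos u).le, ← Real.exp_mul, mul_comm u p] at h2
  have h3 := Real.abs_exp_sub_one_sub_id_le hu
  have h4 := le_abs_self (Real.exp (p * u) - 1 - p * u)
  exact h2.trans (mul_le_mul_of_nonneg_left (by linarith) (Real.rpow_nonneg hV p))

/-- Elementary part of the moment estimate: bound for the square of
`2 w s + C h Q` with `s = ∑ β_r z_r` and `Q = 1 + ∑ z_r²`. -/
lemma sq_noise_le {β : Fin m → ℝ} {G C w : ℝ} (hG : 0 ≤ G) (hβ : ∀ r, |β r| ≤ G)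
    (hz : ∀ r, |z r| ≤ Z) (hC : 0 ≤ C) (hw : 0 ≤ w) :
    |2 * w * ∑ r, β r * z r + C * (w * w) * (1 + ∑ r, z r ^ 2)|
        ≤ 2 * m * G * (w * Z) + C * (w * w + m * (w * Z) ^ 2) ∧
    (2 * w * ∑ r, β r * z r + C * (w * w) * (1 + ∑ r, z r ^ 2)) ^ 2
      ≤ (8 * m * G ^ 2 + 2 * C * (C * (w * w + m * (w * Z) ^ 2)))
        * (w * w) * (1 + ∑ r, z r ^ 2) := by
  have hZr : ∀ r, z r ^ 2 ≤ Z ^ 2 := fun r => sq_le_sq' (by linarith [abs_le.mp (hz r)])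
    (abs_le.mp (hz r)).2
  have hsum2 : ∑ r, z r ^ 2 ≤ m * Z ^ 2 :=
    (Finset.sum_le_card_nsmul _ _ (Z ^ 2) fun r _ => hZr r).trans (by simp)
  have hsum0 : 0 ≤ ∑ r, z r ^ 2 := Finset.sum_nonneg fun r _ => sq_nonneg _
  have hsabs : |∑ r, β r * z r| ≤ m * (G * Z) := by
    refine (Finset.abs_sum_le_sum_abs _ _).trans ?_
    refine (Finset.sum_le_card_nsmul _ _ (G * Z) fun r _ => ?_).trans (by simp)
    rw [abs_mul]
    exact mul_le_mul (hβ r) (hz r) (abs_nonneg _) hG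
  -- Cauchy–Schwarz keeps z_r² instead of Z²: with Z = A_h the latter would cost a factor |ln h| in
  -- the mean.
  have hs2 : (∑ r, β r * z r) ^ 2 ≤ m * G ^ 2 * (1 + ∑ r, z r ^ 2) := by
    have h2 : ∑ r, β r ^ 2 ≤ m * G ^ 2 := by
      refine (Finset.sum_le_card_nsmul _ _ (G ^ 2) fun r _ => ?_).trans (by simp)
      exact sq_le_sq' (by linarith [abs_le.mp (hβ r)]) (abs_le.mp (hβ r)).2
    refine (Finset.sum_mul_sq_le_sq_mul_sq _ _ _).trans ?_
    exact mul_le_mul h2 (by linarith) hsum0 (by positivity)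
  generalize ∑ r, β r * z r = s at *
  generalize ∑ r, z r ^ 2 = q at *
  have hQ0 : 0 ≤ C * (w * w) * (1 + q) := by positivity
  have hQ1 : C * (w * w) * (1 + q) ≤ C * (w * w + m * (w * Z) ^ 2) := by
    have h1 : C * (w * w) * q ≤ C * (w * w) * (m * Z ^ 2) := by gcongr
    linarith
  constructor
  · refine (abs_add_le _ _).trans ?_
    rw [abs_of_nonneg hQ0, abs_mul, abs_of_nonneg (by positivity)]
    have h1 := mul_le_mul_of_nonneg_left hsabs (by positivity : 0 ≤ 2 * w)
    linarith
  · have h1 : (2 * w * s + C * (w * w) * (1 + q)) ^ 2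
        ≤ 2 * (2 * w * s) ^ 2 + 2 * (C * (w * w) * (1 + q)) ^ 2 := by
      nlinarith [sq_nonneg (2 * w * s - C * (w * w) * (1 + q))]
    have h2 := mul_le_mul_of_nonneg_left hs2 (by positivity : 0 ≤ 8 * (w * w))
    have h3 := mul_le_mul_of_nonneg_left hQ1 hQ0
    linarith

/-- Bound for `‖y‖^{2p}` after a step of small size `h`. -/
lemma FieldBounds.rpow_step_le (H : FieldBounds A S B c₁ a₀ L₁ L₀ L₂ b₀)
    (hc₁ : 0 ≤ c₁) (ha₀ : 0 ≤ a₀) (hL₁ : 0 ≤ L₁) (hL₀ : 0 ≤ L₀) (hL₂ : 0 ≤ L₂) (hb₀ : 0 ≤ b₀)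
    (hlam : 1 / 2 < lam) (hlam1 : lam ≤ 1) (hh : 0 ≤ h) (hz : ∀ r, |z r| ≤ Z)
    (hsmall1 : 16 * (c₁ + a₀ + m * (L₂ + b₀)) * h ≤ 2 * lam - 1)
    (hsmall2 : 8 * m * L₁ * (Real.sqrt h * Z) ≤ 2 * lam - 1)
    {p C₁ : ℝ} (hp : 1 ≤ p)
    (hC₁ : C₁ = 4 * (c₁ + a₀ + m * (L₂ + b₀)) + 4 * (L₀ + 2 * L₁) ^ 2 * (m + 1) / (2 * lam - 1))
    (hsmall3 : p * (2 * m * (L₀ + L₁) * (Real.sqrt h * Z)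
      + C₁ * (h + m * (Real.sqrt h * Z) ^ 2)) ≤ 1)
    {x y : E}
    (hy : y = x + stepIncrement A S B lam h z ((1 - lam) • x + lam • y)) :
    (1 + ‖y‖ ^ 2) ^ p ≤ (1 + ‖x‖ ^ 2) ^ p
      * (1 + Real.sqrt h * ∑ r, (2 * p * (inner ℝ x (S r x) / (1 + ‖x‖ ^ 2))) * z r
        + (p * C₁ + p ^ 2 * (8 * m * (L₀ + L₁) ^ 2 + 2 * C₁)) * h * (1 + ∑ r, z r ^ 2)) := by
  have key := H.normSq_step_le hc₁ ha₀ hL₁ hL₀ hL₂ hb₀ hlam hlam1 hh hz hsmall1 hsmall2 hy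
  rw [← hC₁] at key
  have hC₁0 : 0 ≤ C₁ := by
    have : 0 < 2 * lam - 1 := by linarith
    rw [hC₁]; positivity
  set w := Real.sqrt h with hw
  have hw0 : 0 ≤ w := Real.sqrt_nonneg h
  have hww : w * w = h := Real.mul_self_sqrt hh
  set V := 1 + ‖x‖ ^ 2 with hV
  have hV0 : 0 < V := by positivity
  set G := L₀ + L₁ with hG
  have hG0 : 0 ≤ G := by positivity
  set β : Fin m → ℝ := fun r => inner ℝ x (S r x) / V with hβ
  have hβle : ∀ r, |β r| ≤ G := by
    intro r
    rw [hβ, abs_div, abs_of_pos hV0, div_le_iff₀ hV0]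
    have h1 := abs_real_inner_le_norm x (S r x)
    have h2 := mul_le_mul_of_nonneg_left (H.norm_diff_le r x) (norm_nonneg x)
    rw [hG, hV]
    nlinarith [mul_nonneg hL₀ (sq_nonneg (‖x‖ - 1)), mul_nonneg hL₀ (sq_nonneg ‖x‖)]
  have hb := sq_noise_le hG0 hβle hz hC₁0 hw0
  rw [hww] at hb
  obtain ⟨hb1, hb2⟩ := hb
  have hsum : ∑ r, (2 * p * (inner ℝ x (S r x) / V)) * z r = 2 * p * ∑ r, β r * z r := by
    rw [Finset.mul_sum]
    exact Finset.sum_congr rfl fun r _ => by rw [hβ]; ring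
  have h1 : ∑ r, z r * inner ℝ x (S r x) = V * ∑ r, β r * z r := by
    rw [Finset.mul_sum]
    refine Finset.sum_congr rfl fun r _ => ?_
    rw [hβ]; field_simp
  rw [h1] at key
  rw [hsum]
  -- The sign of Z is known only through some `z r`, hence the separate case m = 0.
  have hwZ : 0 ≤ m * (w * Z) := by
    rcases m.eq_zero_or_pos with hm | hm
    · simp [hm]
    · have : 0 ≤ Z := (abs_nonneg _).trans (hz ⟨0, hm⟩)
      positivity
  have hQ0 : 0 ≤ 1 + ∑ r, z r ^ 2 := by
    have := Finset.sum_nonneg fun r (_ : r ∈ Finset.univ) => sq_nonneg (z r)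
    linarith
  generalize ∑ r, β r * z r = s at *
  generalize 1 + ∑ r, z r ^ 2 = Q at *
  have hstep : 1 + ‖y‖ ^ 2 ≤ V * (1 + (2 * w * s + C₁ * h * Q)) := by linarith
  have hu1 : |p * (2 * w * s + C₁ * h * Q)| ≤ 1 := by
    rw [abs_mul, abs_of_nonneg (by linarith)]
    exact (mul_le_mul_of_nonneg_left hb1 (by linarith)).trans hsmall3
  -- Uses p ≥ 1; it reduces the factor 2C₁ · C₁(h + m(wZ)²) from `sq_noise_le` to 2C₁.
  have hCQ1 : C₁ * (h + m * (w * Z) ^ 2) ≤ 1 := by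
    have h2 : 0 ≤ C₁ * (h + m * (w * Z) ^ 2) := by positivity
    have h3 : 0 ≤ 2 * m * G * (w * Z) := by
      have := mul_nonneg hG0 hwZ
      linarith
    nlinarith
  have hmain := rpow_le_rpow_mul_of_le_mul_one_add hV0.le (by positivity) (by linarith) hstep hu1
  refine hmain.trans (mul_le_mul_of_nonneg_left ?_ (Real.rpow_nonneg hV0.le p))
  have hu2 : (2 * w * s + C₁ * h * Q) ^ 2 ≤ (8 * m * G ^ 2 + 2 * C₁) * h * Q := by
    have h2 := mul_le_mul_of_nonneg_left hCQ1 (by positivity : 0 ≤ 2 * C₁ * h * Q)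
    linarith
  rw [mul_pow]
  have := mul_le_mul_of_nonneg_left hu2 (sq_nonneg p)
  linarith

end SmallStep

/-! ### Size of √h A_h -/

lemma truncLevel_nonneg (l h : ℝ) : 0 ≤ truncLevel l h := Real.sqrt_nonneg _

/-- In this form the product extends continuously to h = 0, as h log h does; both its smallness near
0 and its boundedness on [0, h₀] follow. -/
lemma sqrt_mul_truncLevel {h : ℝ} (hh : 0 ≤ h) (l : ℝ) :
    Real.sqrt h * truncLevel l h = Real.sqrt (2 * l * |h * Real.log h|) := by
  rw [truncLevel, ← Real.sqrt_mul hh, abs_mul, abs_of_nonneg hh]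
  congr 1
  ring

lemma continuous_sqrt_mul_abs_mul_log (l : ℝ) :
    Continuous fun h : ℝ => Real.sqrt (2 * l * |h * Real.log h|) := by
  have := Real.continuous_mul_log
  fun_prop

lemma exists_sqrt_mul_truncLevel_le (l : ℝ) {ρ : ℝ} (hρ : 0 < ρ) :
    ∃ h₁ : ℝ, 0 < h₁ ∧ ∀ h, 0 < h → h ≤ h₁ → h ≤ ρ ∧ Real.sqrt h * truncLevel l h ≤ ρ := by
  have hc := (continuous_sqrt_mul_abs_mul_log l).tendsto 0
  simp only [zero_mul, abs_zero, mul_zero, Real.sqrt_zero] at hc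
  obtain ⟨δ, hδ, H⟩ := Metric.eventually_nhds_iff.mp (hc.eventually (gt_mem_nhds hρ))
  refine ⟨min ρ (δ / 2), by positivity, fun h hh hle => ⟨hle.trans (min_le_left _ _), ?_⟩⟩
  rw [sqrt_mul_truncLevel hh.le]
  refine (H ?_).le
  rw [Real.dist_eq, sub_zero, abs_of_pos hh]
  linarith [hle.trans (min_le_right _ _)]

lemma exists_forall_sqrt_mul_truncLevel_le (l h₀ : ℝ) :
    ∃ M : ℝ, 0 ≤ M ∧ ∀ h, 0 < h → h ≤ h₀ → Real.sqrt h * truncLevel l h ≤ M := by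
  obtain ⟨M, hM⟩ := (isCompact_Icc (a := (0 : ℝ)) (b := h₀)).bddAbove_image
    (continuous_sqrt_mul_abs_mul_log l).continuousOn
  refine ⟨max M 0, le_max_right _ _, fun h hh hle => ?_⟩
  rw [sqrt_mul_truncLevel hh.le]
  exact (hM ⟨h, ⟨hh.le, hle⟩, rfl⟩).trans (le_max_left _ _)

/-! ### One-step bound for all admissible step sizes -/

lemma FieldBounds.continuous_diff {E : Type*} [NormedAddCommGroup E] [InnerProductSpace ℝ E]
    {m : ℕ} {A : E → E} {S B : Fin m → E → E} {c₁ a₀ L₁ L₀ L₂ b₀ : ℝ}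
    (H : FieldBounds A S B c₁ a₀ L₁ L₀ L₂ b₀) (r : Fin m) : Continuous (S r) :=
  (LipschitzWith.of_dist_le' (K := L₁) fun x y => by
    rw [dist_eq_norm, dist_eq_norm]; exact H.diff r x y).continuous

/-- Crude bound for `‖y‖^{2p}` after a step of arbitrary admissible size. -/
lemma FieldBounds.rpow_step_le_mul {E : Type*} [NormedAddCommGroup E] [InnerProductSpace ℝ E]
    {m : ℕ} {A : E → E} {S B : Fin m → E → E} {c₁ a₀ L₁ L₀ L₂ b₀ lam h Z ε : ℝ} {z : Fin m → ℝ}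
    (H : FieldBounds A S B c₁ a₀ L₁ L₀ L₂ b₀)
    (hlam : 1 / 2 < lam) (hlam1 : lam ≤ 1) (hh : 0 ≤ h) (hz : ∀ r, |z r| ≤ Z) (hε : 0 < ε)
    (hθ : lam * (h * c₁ + m * lam * L₂ * h + m * L₁ * (Real.sqrt h * Z)) ≤ 1 - ε) {c p : ℝ}
    (hc : h * a₀ + lam * h * (m * b₀) + m * (Z * Real.sqrt h * L₀) ≤ c) (hp : 0 ≤ p) {x y : E}
    (hy : y = x + stepIncrement A S B lam h z ((1 - lam) • x + lam • y)) :
    (1 + ‖y‖ ^ 2) ^ p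
      ≤ (1 + ‖x‖ ^ 2) ^ p * (1 + 8 * ((1 / ε + 1) ^ 2 + (c / ε) ^ 2)) ^ p := by
  have hy1 := H.norm_step_le hlam hlam1 hh hz hε hθ hy
  have hy2 : ‖y‖ ≤ 2 * ((1 / ε + 1) * ‖x‖ + c / ε) := by
    refine hy1.trans ?_
    have h1 : (‖x‖ + (h * a₀ + lam * h * (m * b₀) + m * (Z * Real.sqrt h * L₀))) / ε
        ≤ (‖x‖ + c) / ε := by gcongr
    have h2 : (‖x‖ + c) / ε = 1 / ε * ‖x‖ + c / ε := by ring
    linarith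
  have hy3 : 1 + ‖y‖ ^ 2 ≤ (1 + ‖x‖ ^ 2) * (1 + 8 * ((1 / ε + 1) ^ 2 + (c / ε) ^ 2)) := by
    have h1 := pow_le_pow_left₀ (norm_nonneg y) hy2 2
    generalize 1 / ε + 1 = α at *
    generalize c / ε = γ at *
    have h2 : (2 * (α * ‖x‖ + γ)) ^ 2 ≤ 8 * ((α * ‖x‖) ^ 2 + γ ^ 2) := by
      linarith [sq_nonneg (α * ‖x‖ - γ)]
    have h3 : 0 ≤ γ ^ 2 * ‖x‖ ^ 2 := by positivity
    have h4 := sq_nonneg α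
    have h5 := sq_nonneg ‖x‖
    linarith
  rw [← Real.mul_rpow (by positivity) (by positivity)]
  exact Real.rpow_le_rpow (by positivity) hy3 hp

/-- One-step moment estimate, uniform over the coefficient fields and the step sizes `h ≤ h₀`. -/
lemma exists_step_moment_bound (E : Type*) [NormedAddCommGroup E] [InnerProductSpace ℝ E] (m : ℕ)
    {lam l c₁ a₀ L₁ L₀ L₂ b₀ ε h₀ p : ℝ}
    (hc₁ : 0 ≤ c₁) (ha₀ : 0 ≤ a₀) (hL₁ : 0 ≤ L₁) (hL₀ : 0 ≤ L₀) (hL₂ : 0 ≤ L₂) (hb₀ : 0 ≤ b₀)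
    (hlam : 1 / 2 < lam) (hlam1 : lam ≤ 1) (hε : 0 < ε) (hh₀ : 0 < h₀) (hp : 1 ≤ p)
    (hstep : ∀ h : ℝ, 0 < h → h ≤ h₀ →
      lam * (h * c₁ + m * lam * L₂ * h + m * L₁ * (Real.sqrt h * truncLevel l h)) ≤ 1 - ε) :
    ∃ C : ℝ, 0 ≤ C ∧ ∀ (A : E → E) (S B : Fin m → E → E),
      FieldBounds A S B c₁ a₀ L₁ L₀ L₂ b₀ → ∀ h : ℝ, 0 < h → h ≤ h₀ →
      ∃ β : Fin m → E → ℝ, (∀ r, Continuous (β r)) ∧ (∀ r x, |β r x| ≤ C) ∧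
        ∀ z : Fin m → ℝ, (∀ r, |z r| ≤ truncLevel l h) → ∀ x y : E,
          y = x + stepIncrement A S B lam h z ((1 - lam) • x + lam • y) →
          (1 + ‖y‖ ^ 2) ^ p ≤ (1 + ‖x‖ ^ 2) ^ p
            * (1 + Real.sqrt h * ∑ r, β r x * z r + C * h * (1 + ∑ r, z r ^ 2)) := by
  have hlam2 : 0 < 2 * lam - 1 := by linarith
  obtain ⟨c, hc⟩ : ∃ c, c = c₁ + a₀ + m * (L₂ + b₀) := ⟨_, rfl⟩
  have hc0 : 0 ≤ c := by rw [hc]; positivity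
  obtain ⟨C₁, hC₁⟩ : ∃ C₁, C₁ = 4 * (c₁ + a₀ + m * (L₂ + b₀))
    + 4 * (L₀ + 2 * L₁) ^ 2 * (m + 1) / (2 * lam - 1) := ⟨_, rfl⟩
  have hC₁0 : 0 ≤ C₁ := by rw [hC₁]; positivity
  obtain ⟨ρ, hρ, hρ1, hρ2, hρ3, hρ4⟩ : ∃ ρ : ℝ, 0 < ρ ∧ ρ ≤ 1 ∧ 16 * c * ρ ≤ 2 * lam - 1 ∧
      8 * m * L₁ * ρ ≤ 2 * lam - 1 ∧ p * (2 * m * (L₀ + L₁) + C₁ * (1 + m)) * ρ ≤ 1 := by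
    -- Thresholds b/(a+b) replace b/a, since a may vanish.
    have aux : ∀ a b : ℝ, 0 ≤ a → 0 < b → a * (b / (a + b)) ≤ b := fun a b ha hb => by
      rw [mul_div_assoc', div_le_iff₀ (by positivity)]
      nlinarith
    have k1 : 0 ≤ 16 * c := by positivity
    have k2 : 0 ≤ 8 * m * L₁ := by positivity
    have k3 : 0 ≤ p * (2 * m * (L₀ + L₁) + C₁ * (1 + m)) := by positivity
    have e1 : 0 < (2 * lam - 1) / (16 * c + (2 * lam - 1)) := by positivity
    have e2 : 0 < (2 * lam - 1) / (8 * m * L₁ + (2 * lam - 1)) := by positivity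
    have e3 : 0 < 1 / (p * (2 * m * (L₀ + L₁) + C₁ * (1 + m)) + 1) := by positivity
    refine ⟨min 1 (min ((2 * lam - 1) / (16 * c + (2 * lam - 1)))
      (min ((2 * lam - 1) / (8 * m * L₁ + (2 * lam - 1)))
        (1 / (p * (2 * m * (L₀ + L₁) + C₁ * (1 + m)) + 1)))), lt_min one_pos
          (lt_min e1 (lt_min e2 e3)), min_le_left _ _, ?_, ?_, ?_⟩
    · exact (mul_le_mul_of_nonneg_left ((min_le_right _ _).trans (min_le_left _ _)) k1).trans
        (aux _ _ k1 hlam2)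
    · exact (mul_le_mul_of_nonneg_left ((min_le_right _ _).trans ((min_le_right _ _).trans
        (min_le_left _ _))) k2).trans (aux _ _ k2 hlam2)
    · exact (mul_le_mul_of_nonneg_left ((min_le_right _ _).trans ((min_le_right _ _).trans
        (min_le_right _ _))) k3).trans (aux _ _ k3 one_pos)
  obtain ⟨h₁, hh₁, Hsmall⟩ := exists_sqrt_mul_truncLevel_le l hρ
  obtain ⟨M, hM0, hM⟩ := exists_forall_sqrt_mul_truncLevel_le l h₀
  obtain ⟨c', hc'⟩ : ∃ c', c' = h₀ * a₀ + h₀ * (m * b₀) + m * (M * L₀) := ⟨_, rfl⟩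
  have hc'0 : 0 ≤ c' := by rw [hc']; positivity
  obtain ⟨C₂, hC₂⟩ : ∃ C₂, C₂ = 1 + 8 * ((1 / ε + 1) ^ 2 + (c' / ε) ^ 2) := ⟨_, rfl⟩
  have hC₂0 : 0 < C₂ := by rw [hC₂]; positivity
  obtain ⟨Cs, hCs⟩ : ∃ Cs, Cs = p * C₁ + p ^ 2 * (8 * m * (L₀ + L₁) ^ 2 + 2 * C₁) := ⟨_, rfl⟩
  have hCs0 : 0 ≤ Cs := by rw [hCs]; positivity
  have hCl0 : 0 ≤ C₂ ^ p / h₁ := by positivity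
  have hCβ0 : 0 ≤ 2 * p * (L₀ + L₁) := by positivity
  -- The three summands serve small steps, large steps, and the bound on β.
  refine ⟨Cs + C₂ ^ p / h₁ + 2 * p * (L₀ + L₁), by positivity, fun A S B H h hh hle => ?_⟩
  have hmono : ∀ (D : ℝ) (z : Fin m → ℝ), D ≤ Cs + C₂ ^ p / h₁ + 2 * p * (L₀ + L₁) →
      D * h * (1 + ∑ r, z r ^ 2)
        ≤ (Cs + C₂ ^ p / h₁ + 2 * p * (L₀ + L₁)) * h * (1 + ∑ r, z r ^ 2) := by
    intro D z hD
    have : 0 ≤ ∑ r, z r ^ 2 := Finset.sum_nonneg fun r _ => sq_nonneg _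
    gcongr
  rcases le_or_gt h h₁ with hcase | hcase
  · obtain ⟨hhρ, hwρ⟩ := Hsmall h hh hcase
    refine ⟨fun r x => 2 * p * (inner ℝ x (S r x) / (1 + ‖x‖ ^ 2)), fun r => ?_, fun r x => ?_,
      fun z hz x y hy => ?_⟩
    · have := H.continuous_diff r
      refine continuous_const.mul (Continuous.div (by fun_prop) (by fun_prop) fun x => ?_)
      positivity
    · rw [abs_mul, abs_of_nonneg (by positivity : 0 ≤ 2 * p), abs_div,
        abs_of_pos (by positivity : 0 < 1 + ‖x‖ ^ 2)]
      have h1 : |inner ℝ x (S r x)| / (1 + ‖x‖ ^ 2) ≤ L₀ + L₁ := by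
        rw [div_le_iff₀ (by positivity)]
        have h1 := abs_real_inner_le_norm x (S r x)
        have h2 := mul_le_mul_of_nonneg_left (H.norm_diff_le r x) (norm_nonneg x)
        nlinarith [mul_nonneg hL₀ (sq_nonneg (‖x‖ - 1)), mul_nonneg hL₀ (sq_nonneg ‖x‖)]
      have h2 := mul_le_mul_of_nonneg_left h1 (by positivity : 0 ≤ 2 * p)
      linarith
    · have hw0 : 0 ≤ Real.sqrt h * truncLevel l h :=
        mul_nonneg (Real.sqrt_nonneg _) (truncLevel_nonneg _ _)
      have s1 : 16 * (c₁ + a₀ + m * (L₂ + b₀)) * h ≤ 2 * lam - 1 := by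
        rw [← hc]
        exact (mul_le_mul_of_nonneg_left hhρ (by positivity)).trans hρ2
      have s2 : 8 * m * L₁ * (Real.sqrt h * truncLevel l h) ≤ 2 * lam - 1 :=
        (mul_le_mul_of_nonneg_left hwρ (by positivity)).trans hρ3
      have s3 : p * (2 * m * (L₀ + L₁) * (Real.sqrt h * truncLevel l h)
          + C₁ * (h + m * (Real.sqrt h * truncLevel l h) ^ 2)) ≤ 1 := by
        refine le_trans ?_ hρ4
        have hw2 : (Real.sqrt h * truncLevel l h) ^ 2 ≤ ρ :=
          (pow_le_of_le_one hw0 (hwρ.trans hρ1) two_ne_zero).trans hwρ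
        calc _ ≤ p * (2 * m * (L₀ + L₁) * ρ + C₁ * (ρ + m * ρ)) := by gcongr
          _ = _ := by ring
      refine (H.rpow_step_le hc₁ ha₀ hL₁ hL₀ hL₂ hb₀ hlam hlam1 hh.le hz s1 s2 hp hC₁ s3 hy).trans
        (mul_le_mul_of_nonneg_left ?_ (by positivity))
      rw [← hCs]
      have := hmono Cs z (by linarith)
      linarith
  -- For h > h₁ no cancellation is needed: the factor C₂^p is at most (C₂^p / h₁) h and fits into
  -- the order-h term, so β = 0.
  · refine ⟨fun _ _ => 0, fun r => continuous_const, fun r x => by rw [abs_zero]; positivity,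
      fun z hz x y hy => ?_⟩
    have hcc : h * a₀ + lam * h * (m * b₀) + m * (truncLevel l h * Real.sqrt h * L₀) ≤ c' := by
      have h1 : lam * h ≤ h₀ := (mul_le_of_le_one_left hh.le hlam1).trans hle
      have h2 : truncLevel l h * Real.sqrt h ≤ M := by rw [mul_comm]; exact hM h hh hle
      rw [hc']
      gcongr
    have hy4 := H.rpow_step_le_mul hlam hlam1 hh.le hz hε (hstep h hh hle) hcc
      (by linarith : 0 ≤ p) hy
    rw [← hC₂] at hy4
    have h5 : C₂ ^ p ≤ C₂ ^ p / h₁ * h * (1 + ∑ r, z r ^ 2) := by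
      have h6 : 0 ≤ ∑ r, z r ^ 2 := Finset.sum_nonneg fun r _ => sq_nonneg _
      have h7 : C₂ ^ p ≤ C₂ ^ p / h₁ * h := by
        rw [div_mul_eq_mul_div, le_div_iff₀ hh₁]
        gcongr
      have h8 : 0 ≤ C₂ ^ p / h₁ * h := by positivity
      exact h7.trans (le_mul_of_one_le_right h8 (by linarith))
    have h9 := hmono (C₂ ^ p / h₁) z (by linarith)
    simp only [zero_mul, Finset.sum_const_zero, mul_zero, add_zero]
    refine hy4.trans (mul_le_mul_of_nonneg_left ?_ (by positivity))
    linarith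

/-! ### Measurability of the implicit step -/

/-- If the implicit equation has at most one solution, the solution is a measurable function of the
data on which it exists. -/
lemma exists_measurable_step_solution {d m : ℕ}
    {A : EuclideanSpace ℝ (Fin d) → EuclideanSpace ℝ (Fin d)}
    {S B : Fin m → EuclideanSpace ℝ (Fin d) → EuclideanSpace ℝ (Fin d)} {lam h Z : ℝ}
    (hA : Continuous A) (hS : ∀ r, Continuous (S r)) (hB : ∀ r, Continuous (B r))
    (huniq : ∀ (z : Fin m → ℝ), (∀ r, |z r| ≤ Z) → ∀ x y y' : EuclideanSpace ℝ (Fin d),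
      y = x + stepIncrement A S B lam h z ((1 - lam) • x + lam • y) →
      y' = x + stepIncrement A S B lam h z ((1 - lam) • x + lam • y') → y = y') :
    ∃ φ : EuclideanSpace ℝ (Fin d) × (Fin m → ℝ) → EuclideanSpace ℝ (Fin d), Measurable φ ∧
      ∀ (z : Fin m → ℝ), (∀ r, |z r| ≤ Z) → ∀ x y : EuclideanSpace ℝ (Fin d),
        y = x + stepIncrement A S B lam h z ((1 - lam) • x + lam • y) → y = φ (x, z) := by
  let G : Set ((EuclideanSpace ℝ (Fin d) × (Fin m → ℝ)) × EuclideanSpace ℝ (Fin d)) :=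
    {q | (∀ r, |q.1.2 r| ≤ Z) ∧
      q.2 = q.1.1 + stepIncrement A S B lam h q.1.2 ((1 - lam) • q.1.1 + lam • q.2)}
  have hG : IsClosed G := by
    have e : G = (⋂ r, {q | |q.1.2 r| ≤ Z}) ∩
        {q | q.2 = q.1.1 + stepIncrement A S B lam h q.1.2 ((1 - lam) • q.1.1 + lam • q.2)} := by
      ext q
      simp [G]
    rw [e]
    refine IsClosed.inter (isClosed_iInter fun r => isClosed_le (by fun_prop) continuous_const)
      (isClosed_eq (by fun_prop) ?_)
    unfold stepIncrement
    fun_prop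
  have hinj : Set.InjOn (Prod.fst : (EuclideanSpace ℝ (Fin d) × (Fin m → ℝ)) ×
      EuclideanSpace ℝ (Fin d) → _) G := by
    rintro ⟨⟨x, z⟩, y⟩ hq ⟨⟨x', z'⟩, y'⟩ hq' he
    obtain ⟨rfl, rfl⟩ : x = x' ∧ z = z' := by simpa using he
    rw [huniq z hq.1 x y y' hq.2 hq'.2]
  -- Lusin–Souslin: a continuous injection on a Borel set is a measurable embedding, so y, as a
  -- function on the closed graph, factors through (x, z) and extends measurably.
  obtain ⟨φ, hφ, hφe⟩ :=
    (continuousOn_fst.measurableEmbedding hG.measurableSet hinj).exists_measurable_extend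
      (g := fun q : G => (q : (EuclideanSpace ℝ (Fin d) × (Fin m → ℝ)) ×
        EuclideanSpace ℝ (Fin d)).2) (by fun_prop) fun _ => ⟨0⟩
  exact ⟨φ, hφ, fun z hz x y hy => (congrFun hφe ⟨((x, z), y), hz, hy⟩).symm⟩

/-! ### Mean and variance of the truncated noise -/

lemma truncNoise_neg (l h x : ℝ) : truncNoise l h (-x) = -truncNoise l h x := by
  have := Real.sqrt_nonneg (2 * l * |Real.log h|)
  unfold truncNoise
  simp only [abs_neg]
  split_ifs with h1 h2 h3 h3
  · rfl
  · unfold truncLevel at *; linarith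
  · rw [neg_neg]
  · simp
  · exact absurd (abs_le.mpr ⟨by linarith, by linarith⟩) h1

lemma abs_truncNoise_le_truncLevel (l h x : ℝ) : |truncNoise l h x| ≤ truncLevel l h := by
  have h0 : 0 ≤ truncLevel l h := Real.sqrt_nonneg _
  unfold truncNoise
  split_ifs with h1 h2
  · exact h1
  · rw [abs_of_nonneg h0]
  · rw [abs_neg, abs_of_nonneg h0]

lemma abs_truncNoise_le_abs (l h x : ℝ) : |truncNoise l h x| ≤ |x| := by
  by_cases h1 : |x| ≤ truncLevel l h
  · rw [truncNoise, if_pos h1]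
  · exact (abs_truncNoise_le_truncLevel l h x).trans (not_le.mp h1).le

@[fun_prop]
lemma measurable_truncNoise (l h : ℝ) : Measurable (truncNoise l h) := by
  unfold truncNoise
  refine Measurable.ite (measurableSet_le (by fun_prop) measurable_const) measurable_id ?_
  exact Measurable.ite (measurableSet_lt measurable_const measurable_id) measurable_const
    measurable_const

/-- An odd function under a symmetric law: the integral equals its own negative. -/
lemma integral_truncNoise_gaussianReal (l h : ℝ) :
    ∫ x, truncNoise l h x ∂(gaussianReal 0 1) = 0 := by
  have h1 : ∫ x, truncNoise l h x ∂(gaussianReal 0 1)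
      = -∫ x, truncNoise l h x ∂(gaussianReal 0 1) := by
    conv_lhs => rw [← neg_zero, ← gaussianReal_map_neg,
      integral_map (by fun_prop) (measurable_truncNoise l h).aestronglyMeasurable]
    simp_rw [truncNoise_neg, integral_neg]
  linarith

/-- Truncation only shrinks |ξ|, so the variance 1 is a bound uniform in h. -/
lemma integral_sq_truncNoise_gaussianReal_le (l h : ℝ) :
    ∫ x, truncNoise l h x ^ 2 ∂(gaussianReal 0 1) ≤ 1 := by
  have h1 : ∫ x, x ^ 2 ∂(gaussianReal 0 1) = 1 := by
    have := variance_eq_sub (memLp_id_gaussianReal (μ := 0) (v := 1) 2)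
    simpa [variance_id_gaussianReal, integral_id_gaussianReal] using this.symm
  rw [← h1]
  refine integral_mono_of_nonneg (.of_forall fun x => sq_nonneg _)
    (memLp_id_gaussianReal (μ := 0) (v := 1) 2).integrable_sq (.of_forall fun x => ?_)
  exact sq_le_sq.mpr (abs_truncNoise_le_abs l h x)

/-! ### Independence of the past and the current noise -/

/-- If `X` is independent of `(Y, Z)` and `Y` of `Z`, then `(X, Y)` is independent of `Z`. -/
lemma indepFun_prodMk_of_indepFun {Ω α β γ : Type*} [MeasurableSpace Ω] [MeasurableSpace α]
    [MeasurableSpace β] [MeasurableSpace γ] {P : Measure Ω} [IsProbabilityMeasure P]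
    {X : Ω → α} {Y : Ω → β} {Z : Ω → γ} (hX : Measurable X) (hY : Measurable Y)
    (hZ : Measurable Z) (h1 : IndepFun X (fun ω => (Y ω, Z ω)) P) (h2 : IndepFun Y Z P) :
    IndepFun (fun ω => (X ω, Y ω)) Z P := by
  have hXY : IndepFun X Y P := h1.comp measurable_id measurable_fst
  rw [indepFun_iff_map_prod_eq_prod_map_map (by fun_prop) (by fun_prop)] at h1 h2 hXY ⊢
  rw [h2] at h1
  rw [hXY]
  have := Measure.isProbabilityMeasure_map (μ := P) hX.aemeasurable
  have := Measure.isProbabilityMeasure_map (μ := P) hY.aemeasurable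
  have := Measure.isProbabilityMeasure_map (μ := P) hZ.aemeasurable
  -- The hypotheses factor the joint law as P_X ⊗ (P_Y ⊗ P_Z); only reassociation remains.
  apply (MeasurableEquiv.prodAssoc (α := α) (β := β) (γ := γ)).map_measurableEquiv_injective
  rw [Measure.prodAssoc_prod, ← h1, Measure.map_map (MeasurableEquiv.measurable _) (by fun_prop)]
  rfl

/-- An independent family with an independent initial variable: the initial variable together with
the members of the family indexed by a set `J` is independent of every other member. -/
lemma indepFun_prodMk_mask {Ω α ι : Type*} [MeasurableSpace Ω] [MeasurableSpace α] [Fintype ι]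
    {P : Measure Ω} [IsProbabilityMeasure P] {X : Ω → α} {ξ : ι → Ω → ℝ}
    (hX : Measurable X) (hξ : ∀ i, Measurable (ξ i)) (hind : iIndepFun ξ P)
    (hXξ : IndepFun X (fun ω i => ξ i ω) P) (J : ι → Prop) [DecidablePred J] {i : ι} (hi : ¬ J i) :
    IndepFun (fun ω => (X ω, fun j => if J j then ξ j ω else 0)) (ξ i) P := by
  -- Masking by 0, instead of restricting to J, keeps the past in one fixed space for every step.
  have hm : ∀ j, Measurable fun v : ι → ℝ => if J j then v j else 0 := fun j => by
    split_ifs <;> fun_prop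
  have hm' : Measurable fun v : ι → ℝ => fun j => if J j then v j else 0 := measurable_pi_lambda _ hm
  refine indepFun_prodMk_of_indepFun hX (hm'.comp (measurable_pi_lambda _ hξ)) (hξ i) ?_ ?_
  · exact hXξ.comp (ψ := fun v : ι → ℝ => ((fun j => if J j then v j else 0), v i))
      measurable_id (hm'.prodMk (measurable_pi_apply i))
  · classical
    have h1 := hind.indepFun_finset (Finset.univ.filter J) {i}
      (Finset.disjoint_singleton_right.mpr (by simpa using hi)) hξ
    have hφ : Measurable fun (v : ↥(Finset.univ.filter J) → ℝ) j =>
        if hj : J j then v ⟨j, by simpa using hj⟩ else 0 := by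
      refine measurable_pi_lambda _ fun j => ?_
      split_ifs <;> fun_prop
    have hψ : Measurable fun v : ↥({i} : Finset ι) → ℝ => v ⟨i, by simp⟩ := measurable_pi_apply _
    exact h1.comp hφ hψ

/-! ### The SDE coefficients at a fixed time -/

/-- The mean value inequality turns the Jacobian bound into a Lipschitz bound, and L₁L₀ bounds ∇σ_r
σ_r at 0. No constant depends on the time s. -/
lemma CoeffAssumption.fieldBounds {d m : ℕ} {t₀ T : ℝ}
    {a : ℝ → EuclideanSpace ℝ (Fin d) → EuclideanSpace ℝ (Fin d)}
    {σ : Fin m → ℝ → EuclideanSpace ℝ (Fin d) → EuclideanSpace ℝ (Fin d)}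
    {c₁ c₂ κ L₁ L₂ a₀ L₀ : ℝ} (H : CoeffAssumption t₀ T a σ c₁ c₂ κ L₁ L₂) (hL₁ : 0 ≤ L₁)
    (ha : ∀ t ∈ Set.Icc t₀ T, ‖a t 0‖ ≤ a₀) (hσ : ∀ r, ∀ t ∈ Set.Icc t₀ T, ‖σ r t 0‖ ≤ L₀)
    {s : ℝ} (hs : s ∈ Set.Icc t₀ T) :
    FieldBounds (a s) (fun r => σ r s) (fun r u => fderiv ℝ (σ r s) u (σ r s u))
      c₁ a₀ L₁ L₀ L₂ (L₁ * L₀) where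
  drift := H.one_sided_lipschitz s hs
  drift_zero := ha s hs
  diff r _ _ := convex_univ.norm_image_sub_le_of_norm_fderiv_le
    (fun u _ => ((H.diffusion_contDiff r s hs).differentiable one_ne_zero) u)
    (fun u _ => H.diffusion_deriv_bound r s hs u) trivial trivial
  diff_zero r := hσ r s hs
  corr := fun r => H.diffusion_corr_lipschitz r s hs
  corr_zero r := (ContinuousLinearMap.le_opNorm _ _).trans
    (mul_le_mul (H.diffusion_deriv_bound r s hs 0) (hσ r s hs) (norm_nonneg _) hL₁)

/-- The polynomial Lipschitz bound enters only here: continuity of the drift makes the graph of the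
implicit step closed. -/
lemma CoeffAssumption.continuous_drift {d m : ℕ} {t₀ T : ℝ}
    {a : ℝ → EuclideanSpace ℝ (Fin d) → EuclideanSpace ℝ (Fin d)}
    {σ : Fin m → ℝ → EuclideanSpace ℝ (Fin d) → EuclideanSpace ℝ (Fin d)}
    {c₁ c₂ κ L₁ L₂ : ℝ} (H : CoeffAssumption t₀ T a σ c₁ c₂ κ L₁ L₂) (hκ : 1 ≤ κ)
    {s : ℝ} (hs : s ∈ Set.Icc t₀ T) : Continuous (a s) := by
  rw [continuous_iff_continuousAt]
  intro x
  rw [ContinuousAt, tendsto_iff_norm_sub_tendsto_zero]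
  have hc : Continuous fun y : EuclideanSpace ℝ (Fin d) =>
      Real.sqrt (c₂ * (1 + ‖y‖ ^ (2 * κ - 2) + ‖x‖ ^ (2 * κ - 2)) * ‖y - x‖ ^ 2) := by
    have : Continuous fun y : EuclideanSpace ℝ (Fin d) => ‖y‖ ^ (2 * κ - 2) :=
      continuous_norm.rpow_const fun _ => Or.inr (by linarith)
    fun_prop
  have ht := hc.tendsto x
  simp only [sub_self, norm_zero, ne_eq, OfNat.ofNat_ne_zero, not_false_eq_true, zero_pow,
    mul_zero, Real.sqrt_zero] at ht
  exact squeeze_zero (fun _ => norm_nonneg _)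
    (fun y => Real.le_sqrt_of_sq_le (H.poly_lipschitz s hs y x)) ht

lemma CoeffAssumption.continuous_corr {d m : ℕ} {t₀ T : ℝ}
    {a : ℝ → EuclideanSpace ℝ (Fin d) → EuclideanSpace ℝ (Fin d)}
    {σ : Fin m → ℝ → EuclideanSpace ℝ (Fin d) → EuclideanSpace ℝ (Fin d)}
    {c₁ c₂ κ L₁ L₂ : ℝ} (H : CoeffAssumption t₀ T a σ c₁ c₂ κ L₁ L₂) (r : Fin m)
    {s : ℝ} (hs : s ∈ Set.Icc t₀ T) : Continuous fun u => fderiv ℝ (σ r s) u (σ r s u) := by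
  have h := H.diffusion_contDiff r s hs
  exact (h.continuous_fderiv one_ne_zero).clm_apply h.continuous

lemma implicitStep_iff {d m : ℕ}
    {a : ℝ → EuclideanSpace ℝ (Fin d) → EuclideanSpace ℝ (Fin d)}
    {σ : Fin m → ℝ → EuclideanSpace ℝ (Fin d) → EuclideanSpace ℝ (Fin d)}
    {lam h s : ℝ} {z : Fin m → ℝ} {x y : EuclideanSpace ℝ (Fin d)} :
    ImplicitStep a σ lam h s z x y ↔
      y = x + stepIncrement (a s) (fun r => σ r s) (fun r u => fderiv ℝ (σ r s) u (σ r s u))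
        lam h z ((1 - lam) • x + lam • y) := by
  simp only [ImplicitStep, stepIncrement]
  rw [← add_assoc, ← add_sub_assoc]

/-! ### Expectations and induction along the scheme -/

/-- Expectation of the one-step bound: the linear noise term vanishes. -/
lemma integral_le_of_noise_bound {Ω : Type*} [MeasurableSpace Ω] {P : Measure Ω}
    [IsProbabilityMeasure P] {F : Type*} [MeasurableSpace F] {m : ℕ} {l h C : ℝ}
    {Y : Ω → F} {ξ : Fin m → Ω → ℝ} {V : F → ℝ} {β : Fin m → F → ℝ} {W : Ω → ℝ}
    (hY : Measurable Y) (hξ : ∀ r, Measurable (ξ r))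
    (hlaw : ∀ r, P.map (ξ r) = gaussianReal 0 1) (hind : ∀ r, IndepFun Y (ξ r) P)
    (hV : Measurable V) (hV0 : ∀ x, 0 ≤ V x) (hβ : ∀ r, Measurable (β r))
    (hβC : ∀ r x, |β r x| ≤ C) (hC : 0 ≤ C) (hh : 0 ≤ h) (hW : AEStronglyMeasurable W P)
    (hW0 : ∀ ω, 0 ≤ W ω) (hVint : Integrable (fun ω => V (Y ω)) P)
    (hle : ∀ᵐ ω ∂P, W ω ≤ V (Y ω) * (1 + Real.sqrt h * ∑ r, β r (Y ω) * truncNoise l h (ξ r ω)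
      + C * h * (1 + ∑ r, truncNoise l h (ξ r ω) ^ 2))) :
    Integrable W P ∧ ∫ ω, W ω ∂P ≤ (1 + C * (1 + m) * h) * ∫ ω, V (Y ω) ∂P := by
  have hζ : ∀ r, Integrable (fun ω => truncNoise l h (ξ r ω)) P := fun r =>
    Integrable.of_bound ((measurable_truncNoise l h).comp (hξ r)).aestronglyMeasurable
      (truncLevel l h) (.of_forall fun ω => abs_truncNoise_le_truncLevel _ _ _)
  have hζ2 : ∀ r, Integrable (fun ω => truncNoise l h (ξ r ω) ^ 2) P := fun r =>
    Integrable.of_bound (((measurable_truncNoise l h).comp (hξ r)).pow_const 2).aestronglyMeasurable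
      (truncLevel l h ^ 2) (.of_forall fun ω => by
        rw [Real.norm_eq_abs, abs_pow]
        exact pow_le_pow_left₀ (abs_nonneg _) (abs_truncNoise_le_truncLevel _ _ _) 2)
  have hVβ : ∀ r, Integrable (fun ω => V (Y ω) * β r (Y ω)) P := fun r =>
    hVint.mul_bdd (c := C) ((hβ r).comp hY).aestronglyMeasurable (.of_forall fun ω => hβC r _)
  -- The factor V(Y)β(Y) depends on the past alone, so the expectation factors and the mean-zero
  -- noise kills it.
  have hlin : ∀ r, Integrable (fun ω => V (Y ω) * β r (Y ω) * truncNoise l h (ξ r ω)) P ∧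
      ∫ ω, V (Y ω) * β r (Y ω) * truncNoise l h (ξ r ω) ∂P = 0 := fun r => by
    have hi : IndepFun (fun ω => V (Y ω) * β r (Y ω)) (fun ω => truncNoise l h (ξ r ω)) P :=
      (hind r).comp (φ := fun x => V x * β r x) (hV.mul (hβ r)) (measurable_truncNoise l h)
    refine ⟨hi.integrable_mul (hVβ r) (hζ r), ?_⟩
    rw [hi.integral_fun_mul_eq_mul_integral (hVβ r).1 (hζ r).1]
    have : ∫ ω, truncNoise l h (ξ r ω) ∂P = 0 := by
      rw [← integral_map (hξ r).aemeasurable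
        (measurable_truncNoise l h).aestronglyMeasurable, hlaw r,
        integral_truncNoise_gaussianReal]
    rw [this, mul_zero]
  have hquad : ∀ r, Integrable (fun ω => V (Y ω) * truncNoise l h (ξ r ω) ^ 2) P ∧
      ∫ ω, V (Y ω) * truncNoise l h (ξ r ω) ^ 2 ∂P ≤ ∫ ω, V (Y ω) ∂P := fun r => by
    have hi : IndepFun (fun ω => V (Y ω)) (fun ω => truncNoise l h (ξ r ω) ^ 2) P :=
      (hind r).comp (ψ := fun x => truncNoise l h x ^ 2) hV
        ((measurable_truncNoise l h).pow_const 2)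
    refine ⟨hi.integrable_mul hVint (hζ2 r), ?_⟩
    rw [hi.integral_fun_mul_eq_mul_integral hVint.1 (hζ2 r).1]
    have : ∫ ω, truncNoise l h (ξ r ω) ^ 2 ∂P ≤ 1 := by
      rw [← integral_map (f := fun x => truncNoise l h x ^ 2) (hξ r).aemeasurable
        ((measurable_truncNoise l h).pow_const 2).aestronglyMeasurable, hlaw r]
      exact integral_sq_truncNoise_gaussianReal_le l h
    exact mul_le_of_le_one_right (integral_nonneg fun ω => hV0 _) this
  have hsplit : ∀ ω, V (Y ω) * (1 + Real.sqrt h * ∑ r, β r (Y ω) * truncNoise l h (ξ r ω)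
      + C * h * (1 + ∑ r, truncNoise l h (ξ r ω) ^ 2))
      = (1 + C * h) * V (Y ω)
        + Real.sqrt h * ∑ r, V (Y ω) * β r (Y ω) * truncNoise l h (ξ r ω)
        + C * h * ∑ r, V (Y ω) * truncNoise l h (ξ r ω) ^ 2 := fun ω => by
    simp only [mul_assoc (V (Y ω)), ← Finset.mul_sum]
    ring
  simp only [hsplit] at hle
  have i1 : Integrable (fun ω => (1 + C * h) * V (Y ω)) P := hVint.const_mul _
  have i2 : Integrable (fun ω => Real.sqrt h *
      ∑ r, V (Y ω) * β r (Y ω) * truncNoise l h (ξ r ω)) P :=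
    (integrable_finsetSum _ fun r _ => (hlin r).1).const_mul _
  have i3 : Integrable (fun ω => C * h * ∑ r, V (Y ω) * truncNoise l h (ξ r ω) ^ 2) P :=
    (integrable_finsetSum _ fun r _ => (hquad r).1).const_mul _
  have i12 : Integrable (fun ω => (1 + C * h) * V (Y ω)
      + Real.sqrt h * ∑ r, V (Y ω) * β r (Y ω) * truncNoise l h (ξ r ω)) P := i1.add i2
  -- Finiteness of the next moment is a conclusion: W ≥ 0 is dominated by an integrable function.
  have hWint : Integrable W P := (i12.add i3).mono' hW (by
    filter_upwards [hle] with ω hω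
    rw [Real.norm_of_nonneg (hW0 ω)]
    exact hω)
  refine ⟨hWint, (integral_mono_ae hWint (i12.add i3) hle).trans ?_⟩
  simp only [Pi.add_apply]
  rw [integral_add i12 i3, integral_add i1 i2, integral_const_mul, integral_const_mul, integral_const_mul,
    integral_finsetSum _ fun r _ => (hlin r).1, integral_finsetSum _ fun r _ => (hquad r).1,
    Finset.sum_eq_zero fun r _ => (hlin r).2]
  have hs : ∑ r, ∫ ω, V (Y ω) * truncNoise l h (ξ r ω) ^ 2 ∂P ≤ m * ∫ ω, V (Y ω) ∂P :=
    (Finset.sum_le_card_nsmul _ _ _ fun r _ => (hquad r).2).trans (by simp)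
  have := mul_le_mul_of_nonneg_left hs (mul_nonneg hC hh)
  linarith

/-- Since 1 + y ≤ 2 max(1, y). With the next lemma it exchanges the propagated moment (1 + ‖x‖²)^p
for ‖x‖^{2p}. -/
lemma one_add_sq_rpow_le {x p : ℝ} (hx : 0 ≤ x) (hp : 0 ≤ p) :
    (1 + x ^ 2) ^ p ≤ 2 ^ p * (1 + x ^ (2 * p)) := by
  have e : x ^ (2 * p) = (x ^ 2) ^ p := by
    rw [Real.rpow_mul hx, ← Real.rpow_natCast]; norm_num
  rw [e]
  generalize hy : x ^ 2 = y
  have hy0 : 0 ≤ y := by rw [← hy]; positivity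
  have h2 : 0 < (2 : ℝ) ^ p := by positivity
  have hyp : 0 ≤ y ^ p := by positivity
  rcases le_total y 1 with h | h
  · have := Real.rpow_le_rpow (by positivity) (by linarith : 1 + y ≤ 2) hp
    nlinarith
  · have := Real.rpow_le_rpow (by positivity) (by linarith : 1 + y ≤ 2 * y) hp
    rw [Real.mul_rpow two_pos.le hy0] at this
    nlinarith

lemma rpow_two_mul_le {x p : ℝ} (hx : 0 ≤ x) (hp : 0 ≤ p) : x ^ (2 * p) ≤ (1 + x ^ 2) ^ p := by
  have e : x ^ (2 * p) = (x ^ 2) ^ p := by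
    rw [Real.rpow_mul hx, ← Real.rpow_natCast]; norm_num
  rw [e]
  exact Real.rpow_le_rpow (by positivity) (by linarith) hp

/-- Induction along the scheme: measurability with respect to the past and moment growth. -/
lemma IsImplicitScheme.moment_growth {d m N : ℕ} {t₀ T lam l h c₁ c₂ κ L₁ L₂ a₀ L₀ ε p C : ℝ}
    {a : ℝ → EuclideanSpace ℝ (Fin d) → EuclideanSpace ℝ (Fin d)}
    {σ : Fin m → ℝ → EuclideanSpace ℝ (Fin d) → EuclideanSpace ℝ (Fin d)}
    (H : CoeffAssumption t₀ T a σ c₁ c₂ κ L₁ L₂) (hκ : 1 ≤ κ) (hL₁ : 0 ≤ L₁)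
    (ha : ∀ t ∈ Set.Icc t₀ T, ‖a t 0‖ ≤ a₀) (hσ : ∀ r, ∀ t ∈ Set.Icc t₀ T, ‖σ r t 0‖ ≤ L₀)
    (hlam : 1 / 2 < lam) (hlam1 : lam ≤ 1) (hε : 0 < ε) (hp : 0 ≤ p) (hh : 0 < h)
    (hN : N * h = T - t₀) (hC : 0 ≤ C)
    (hθ : lam * (h * c₁ + m * lam * L₂ * h + m * L₁ * (Real.sqrt h * truncLevel l h)) ≤ 1 - ε)
    (hbound : ∀ (A : EuclideanSpace ℝ (Fin d) → EuclideanSpace ℝ (Fin d))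
      (S B : Fin m → EuclideanSpace ℝ (Fin d) → EuclideanSpace ℝ (Fin d)),
      FieldBounds A S B c₁ a₀ L₁ L₀ L₂ (L₁ * L₀) →
      ∃ β : Fin m → EuclideanSpace ℝ (Fin d) → ℝ, (∀ r, Continuous (β r)) ∧
        (∀ r x, |β r x| ≤ C) ∧
        ∀ z : Fin m → ℝ, (∀ r, |z r| ≤ truncLevel l h) → ∀ x y : EuclideanSpace ℝ (Fin d),
          y = x + stepIncrement A S B lam h z ((1 - lam) • x + lam • y) →
          (1 + ‖y‖ ^ 2) ^ p ≤ (1 + ‖x‖ ^ 2) ^ p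
            * (1 + Real.sqrt h * ∑ r, β r x * z r + C * h * (1 + ∑ r, z r ^ 2)))
    {Ω : Type*} [MeasurableSpace Ω] {P : Measure Ω} [IsProbabilityMeasure P]
    {ξ : Fin N → Fin m → Ω → ℝ} {X : Fin (N + 1) → Ω → EuclideanSpace ℝ (Fin d)}
    (hξ : ∀ k r, Measurable (ξ k r)) (hlaw : ∀ k r, P.map (ξ k r) = gaussianReal 0 1)
    (hind : iIndepFun (fun (i : Fin N × Fin m) => ξ i.1 i.2) P) (hX0 : Measurable (X 0))
    (hX0ξ : IndepFun (X 0) (fun ω (i : Fin N × Fin m) => ξ i.1 i.2 ω) P)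
    (hint : Integrable (fun ω => (1 + ‖X 0 ω‖ ^ 2) ^ p) P)
    (hX : IsImplicitScheme P a σ t₀ lam l h ξ X) (k : ℕ) (hk : k < N + 1) :
    (∃ g : EuclideanSpace ℝ (Fin d) × (Fin N × Fin m → ℝ) → EuclideanSpace ℝ (Fin d),
      Measurable g ∧ X ⟨k, hk⟩ =ᵐ[P]
        fun ω => g (X 0 ω, fun i => if (i.1 : ℕ) < k then ξ i.1 i.2 ω else 0)) ∧
    Integrable (fun ω => (1 + ‖X ⟨k, hk⟩ ω‖ ^ 2) ^ p) P ∧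
    ∫ ω, (1 + ‖X ⟨k, hk⟩ ω‖ ^ 2) ^ p ∂P
      ≤ (1 + C * (1 + m) * h) ^ k * ∫ ω, (1 + ‖X 0 ω‖ ^ 2) ^ p ∂P := by
  induction k with
  | zero => exact ⟨⟨Prod.fst, measurable_fst, .rfl⟩, hint, by simp⟩
  | succ k ih =>
    obtain ⟨⟨g, hg, hgX⟩, hkint, hkle⟩ := ih (by omega)
    have hkN : k < N := by omega
    have hs : t₀ + (k : ℝ) * h + lam * h ∈ Set.Icc t₀ T := by
      have h1 : ((k : ℝ) + 1) * h ≤ N * h := by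
        have : (k : ℝ) + 1 ≤ N := by exact_mod_cast hkN
        gcongr
      have h2 : 0 ≤ (k : ℝ) * h := by positivity
      constructor <;> nlinarith
    have HF := H.fieldBounds hL₁ ha hσ hs
    obtain ⟨β, hβ, hβC, hstep⟩ := hbound _ _ _ HF
    obtain ⟨φ, hφ, hφstep⟩ := exists_measurable_step_solution (lam := lam) (h := h)
      (Z := truncLevel l h) (H.continuous_drift hκ hs)
      (fun r => (H.diffusion_contDiff r _ hs).continuous) (fun r => H.continuous_corr r hs)
      (fun z hz x y y' hy hy' => HF.step_unique (by linarith) hh.le hz hε hθ hy hy')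
    have hrec := hX ⟨k, hkN⟩
    simp only [implicitStep_iff, Fin.castSucc_mk, Fin.succ_mk] at hrec
    have hz : ∀ ω r, |truncNoise l h (ξ ⟨k, hkN⟩ r ω)| ≤ truncLevel l h := fun ω r =>
      abs_truncNoise_le_truncLevel _ _ _
    have hmask : Measurable fun v : Fin N × Fin m → ℝ => fun i : Fin N × Fin m =>
        if (i.1 : ℕ) < k then v i else 0 := by
      refine measurable_pi_lambda _ fun i => ?_
      split_ifs <;> fun_prop
    -- X_{k+1} is φ of X_k and ζ_k: the mask `< k + 1` still contains the k-th noise, and masking it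
    -- again by `< k` recovers the argument of g.
    have hnew : X ⟨k + 1, hk⟩ =ᵐ[P] fun ω =>
        (fun q : EuclideanSpace ℝ (Fin d) × (Fin N × Fin m → ℝ) =>
          φ (g (q.1, fun i => if (i.1 : ℕ) < k then q.2 i else 0),
            fun r => truncNoise l h (q.2 (⟨k, hkN⟩, r))))
        (X 0 ω, fun i => if (i.1 : ℕ) < k + 1 then ξ i.1 i.2 ω else 0) := by
      filter_upwards [hrec, hgX] with ω hω hgω
      rw [hφstep _ (hz ω) _ _ hω, hgω]
      have e : (fun i : Fin N × Fin m => if (i.1 : ℕ) < k then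
          (if (i.1 : ℕ) < k + 1 then ξ i.1 i.2 ω else 0) else 0)
          = fun i => if (i.1 : ℕ) < k then ξ i.1 i.2 ω else 0 := by
        funext i
        split_ifs <;> first | rfl | omega
      simp only [e]
      simp
    have hgm : Measurable fun q : EuclideanSpace ℝ (Fin d) × (Fin N × Fin m → ℝ) =>
        φ (g (q.1, fun i => if (i.1 : ℕ) < k then q.2 i else 0),
          fun r => truncNoise l h (q.2 (⟨k, hkN⟩, r))) := by
      refine hφ.comp ((hg.comp (measurable_fst.prodMk (hmask.comp measurable_snd))).prodMk ?_)
      exact measurable_pi_lambda _ fun r => (measurable_truncNoise l h).comp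
        ((measurable_pi_apply _).comp measurable_snd)
    have hpast : ∀ n : ℕ, Measurable fun ω =>
        (X 0 ω, fun i : Fin N × Fin m => if (i.1 : ℕ) < n then ξ i.1 i.2 ω else 0) := fun n => by
      refine hX0.prodMk (measurable_pi_lambda _ fun i => ?_)
      split_ifs
      · exact hξ _ _
      · exact measurable_const
    refine ⟨⟨_, hgm, hnew⟩, ?_⟩
    have hXm : AEStronglyMeasurable (X ⟨k + 1, hk⟩) P :=
      ((hgm.comp (hpast (k + 1))).aestronglyMeasurable).congr hnew.symm
    have hWm : AEStronglyMeasurable (fun ω => (1 + ‖X ⟨k + 1, hk⟩ ω‖ ^ 2) ^ p) P := by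
      have hc : Continuous fun x : EuclideanSpace ℝ (Fin d) => (1 + ‖x‖ ^ 2) ^ p :=
        (by fun_prop : Continuous fun x : EuclideanSpace ℝ (Fin d) => 1 + ‖x‖ ^ 2).rpow_const
          fun _ => Or.inr hp
      exact hc.comp_aestronglyMeasurable hXm
    have hVeq : (fun ω => (1 + ‖X ⟨k, by omega⟩ ω‖ ^ 2) ^ p) =ᵐ[P] fun ω => (1 + ‖g (X 0 ω,
        fun i => if (i.1 : ℕ) < k then ξ i.1 i.2 ω else 0)‖ ^ 2) ^ p := by
      filter_upwards [hgX] with ω hω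
      rw [hω]
    -- Y is the whole past and not X_k, because X_k agrees only almost everywhere with the
    -- measurable function g of the past.
    have hmain := integral_le_of_noise_bound (P := P) (l := l) (h := h) (C := C)
      (Y := fun ω => (X 0 ω, fun i : Fin N × Fin m => if (i.1 : ℕ) < k then ξ i.1 i.2 ω else 0))
      (ξ := ξ ⟨k, hkN⟩) (V := fun q => (1 + ‖g q‖ ^ 2) ^ p) (β := fun r q => β r (g q))
      (W := fun ω => (1 + ‖X ⟨k + 1, hk⟩ ω‖ ^ 2) ^ p) (hpast k) (hξ _) (hlaw _)
      (fun r => indepFun_prodMk_mask (ξ := fun i : Fin N × Fin m => ξ i.1 i.2) hX0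
        (fun i => hξ _ _) hind hX0ξ (fun i => (i.1 : ℕ) < k) (i := (⟨k, hkN⟩, r)) (by simp))
      ((measurable_const.add (hg.norm.pow_const 2)).pow_const p)
      (fun q => by positivity) (fun r => (hβ r).measurable.comp hg) (fun r q => hβC r _) hC hh.le
      hWm (fun ω => by positivity) (hkint.congr hVeq) (by
        filter_upwards [hrec, hgX] with ω hω hgω
        rw [← hgω]
        exact hstep _ (hz ω) _ _ hω)
    refine ⟨hmain.1, hmain.2.trans ?_⟩
    rw [← integral_congr_ae hVeq, pow_succ', mul_assoc (1 + C * (1 + m) * h)]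
    exact mul_le_mul_of_nonneg_left hkle (by positivity)

theorem mainTheorem6 (d m : ℕ) (t₀ T : ℝ) (hT : t₀ < T)
    (lam : ℝ) (hlam : 1 / 2 < lam) (hlam1 : lam ≤ 1)
    (l : ℝ) (hl : 1 ≤ l)
    (c₁ c₂ κ L₁ L₂ : ℝ) (hc₁ : 0 ≤ c₁) (hc₂ : 0 ≤ c₂) (hκ : 1 ≤ κ) (hL₁ : 0 ≤ L₁) (hL₂ : 0 ≤ L₂)
    -- bounds for `|a(t,0)|` and `|σ_r(t,0)|` on `[t₀,T]`
    (a₀ L₀ : ℝ)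
    (ε : ℝ) (hε : 0 < ε) (hε1 : ε < 1)
    (h₀ : ℝ) (hh₀ : 0 < h₀)
    (hstep : ∀ h : ℝ, 0 < h → h ≤ h₀ →
      lam * (h * c₁ + m * lam * L₂ * h + m * L₁ * Real.sqrt (2 * l * h * |Real.log h|)) ≤ 1 - ε)
    (p : ℝ) (hp : 1 ≤ p) :
    ∃ K : ℝ, 0 < K ∧
      ∀ (a : ℝ → EuclideanSpace ℝ (Fin d) → EuclideanSpace ℝ (Fin d))
        (σ : Fin m → ℝ → EuclideanSpace ℝ (Fin d) → EuclideanSpace ℝ (Fin d)),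
        CoeffAssumption t₀ T a σ c₁ c₂ κ L₁ L₂ →
        (∀ t ∈ Set.Icc t₀ T, ‖a t 0‖ ≤ a₀) →
        (∀ r, ∀ t ∈ Set.Icc t₀ T, ‖σ r t 0‖ ≤ L₀) →
      ∀ (Ω : Type*) [MeasurableSpace Ω] (P : Measure Ω) [IsProbabilityMeasure P]
        (N : ℕ) (h : ℝ) (ξ : Fin N → Fin m → Ω → ℝ)
        (X : Fin (N + 1) → Ω → EuclideanSpace ℝ (Fin d)),
        -- uniform grid with `t_N = T` and admissible step
        N * h = T - t₀ → 0 < h → h ≤ h₀ →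
        -- i.i.d. standard normal variables, independent of the initial value
        (∀ k r, Measurable (ξ k r)) →
        (∀ k r, P.map (ξ k r) = gaussianReal 0 1) →
        iIndepFun (fun (i : Fin N × Fin m) => ξ i.1 i.2) P →
        Measurable (X 0) →
        IndepFun (X 0) (fun ω (i : Fin N × Fin m) => ξ i.1 i.2 ω) P →
        -- all moments of the initial value are finite
        (∀ q : ℝ, 1 ≤ q → Integrable (fun ω => ‖X 0 ω‖ ^ (2 * q)) P) →
        IsImplicitScheme P a σ t₀ lam l h ξ X →
        ∀ k : Fin (N + 1),
          Integrable (fun ω => ‖X k ω‖ ^ (2 * p)) P ∧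
          ∫ ω, ‖X k ω‖ ^ (2 * p) ∂P ≤ K * (1 + ∫ ω, ‖X 0 ω‖ ^ (2 * p) ∂P) := by
  have hstep' : ∀ h : ℝ, 0 < h → h ≤ h₀ →
      lam * (h * c₁ + m * lam * L₂ * h + m * L₁ * (Real.sqrt h * truncLevel l h)) ≤ 1 - ε := by
    intro h hh hle
    have e : Real.sqrt h * truncLevel l h = Real.sqrt (2 * l * h * |Real.log h|) := by
      rw [sqrt_mul_truncLevel hh.le, abs_mul, abs_of_pos hh, mul_assoc (2 * l)]
    rw [e]
    exact hstep h hh hle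
  have hp0 : 0 ≤ p := by linarith
  -- The constants a₀ and L₀ carry no sign hypothesis, hence the absolute values.
  obtain ⟨C, hC, hbound⟩ := exists_step_moment_bound (EuclideanSpace ℝ (Fin d)) m (l := l) hc₁
    (abs_nonneg a₀) hL₁ (abs_nonneg L₀) hL₂ (mul_nonneg hL₁ (abs_nonneg L₀)) hlam hlam1 hε hh₀ hp
    hstep'
  -- The exponential bounds the product of the one-step factors; 2^p comes from `one_add_sq_rpow_le`
  -- at X_0.
  refine ⟨Real.exp (C * (1 + m) * (T - t₀)) * 2 ^ p, by positivity, ?_⟩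
  intro a σ H ha hσ Ω _ P _ N h ξ X hN hh hle hξ hlaw hind hX0 hX0ξ hmom hX k
  have hmom_p := hmom p hp
  have hint : Integrable (fun ω => (1 + ‖X 0 ω‖ ^ 2) ^ p) P := by
    refine (((integrable_const (1 : ℝ)).add hmom_p).const_mul (2 ^ p)).mono'
      (((measurable_const.add (hX0.norm.pow_const 2)).pow_const p).aestronglyMeasurable)
      (.of_forall fun ω => ?_)
    rw [Real.norm_of_nonneg (by positivity)]
    exact one_add_sq_rpow_le (norm_nonneg _) hp0
  obtain ⟨⟨g, hg, hgX⟩, hkint, hkle⟩ := hX.moment_growth H hκ hL₁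
    (fun t ht => (ha t ht).trans (le_abs_self _)) (fun r t ht => (hσ r t ht).trans (le_abs_self _))
    hlam hlam1 hε hp0 hh hN hC (hstep' h hh hle) (fun A S B HF => hbound A S B HF h hh hle)
    hξ hlaw hind hX0 hX0ξ hint k k.isLt
  have hXm : AEMeasurable (X k) P := by
    refine ⟨_, hg.comp (hX0.prodMk (measurable_pi_lambda _ fun i => ?_)), hgX⟩
    split_ifs
    · exact hξ _ _
    · exact measurable_const
  have hkint' : Integrable (fun ω => ‖X k ω‖ ^ (2 * p)) P :=
    hkint.mono' (hXm.norm.pow_const _).aestronglyMeasurable (.of_forall fun ω => by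
      rw [Real.norm_of_nonneg (by positivity)]
      exact rpow_two_mul_le (norm_nonneg _) hp0)
  refine ⟨hkint', ?_⟩
  have hpow : (1 + C * (1 + m) * h) ^ (k : ℕ) ≤ Real.exp (C * (1 + m) * (T - t₀)) := by
    have hx : 0 ≤ C * (1 + m) * h := by positivity
    have hkN : ((k : ℕ) : ℝ) ≤ N := by exact_mod_cast Nat.lt_succ_iff.mp k.isLt
    calc (1 + C * (1 + m) * h) ^ (k : ℕ) ≤ Real.exp (C * (1 + m) * h) ^ (k : ℕ) := by
          gcongr
          linarith [Real.add_one_le_exp (C * (1 + m) * h)]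
      _ = Real.exp ((k : ℕ) * (C * (1 + m) * h)) := (Real.exp_nat_mul _ _).symm
      _ ≤ Real.exp (C * (1 + m) * (T - t₀)) := by
          rw [← hN, Real.exp_le_exp]
          nlinarith [mul_le_mul_of_nonneg_right hkN hx]
  have h0 : ∫ ω, (1 + ‖X 0 ω‖ ^ 2) ^ p ∂P ≤ 2 ^ p * (1 + ∫ ω, ‖X 0 ω‖ ^ (2 * p) ∂P) := by
    have e : 2 ^ p * (1 + ∫ ω, ‖X 0 ω‖ ^ (2 * p) ∂P)
        = ∫ ω, 2 ^ p * (1 + ‖X 0 ω‖ ^ (2 * p)) ∂P := by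
      rw [integral_const_mul, integral_add (integrable_const _) hmom_p]
      simp
    rw [e]
    exact integral_mono hint (((integrable_const (1 : ℝ)).add hmom_p).const_mul (2 ^ p))
      fun ω => one_add_sq_rpow_le (norm_nonneg _) hp0
  calc ∫ ω, ‖X k ω‖ ^ (2 * p) ∂P ≤ ∫ ω, (1 + ‖X k ω‖ ^ 2) ^ p ∂P :=
        integral_mono hkint' hkint fun ω => rpow_two_mul_le (norm_nonneg _) hp0
    _ ≤ (1 + C * (1 + m) * h) ^ (k : ℕ) * ∫ ω, (1 + ‖X 0 ω‖ ^ 2) ^ p ∂P := hkle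
    _ ≤ Real.exp (C * (1 + m) * (T - t₀)) * (2 ^ p * (1 + ∫ ω, ‖X 0 ω‖ ^ (2 * p) ∂P)) :=
        mul_le_mul hpow h0 (integral_nonneg fun ω => by positivity) (Real.exp_pos _).le
    _ = _ := by ring
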